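/- Let $\gamma\in(0,\infty)$ and let $p=p(n)$ satisfy $p/n\to\gamma$. For each $n$ let $X=Q^\top DO\in\mathbb R^{n\times p}$ be a right-rotationally invariant random design, given by its singular value decomposition: $Q$ is a random $n\times n$ orthogonal matrix, $D$ is a random $n\times p$ rectangular diagonal matrix with nonnegative diagonal, and $O$ is Haar distributed on the orthogonal group $\mathbb O(p)$ and independent of $(Q,D)$. Let $o_i$ be the $i$-th row of $O$, and assume that almost surely all entries of $D$ are bounded by a constant $C$ for all large $n$. Let $\mathcal J_a$ be a fixed finite set of indices, let $(\alpha_i)_{i\in\mathcal J_a}$ be fixed real numbers, and suppose $$y=X\beta+\varepsilon,\qquad \beta=\beta'+\sum_{i\in\mathcal J_a}\sqrt n\,\alpha_i o_i,$$ where $\beta'\in\mathbb R^p$ is fixed or random, independent of $(Q,D,O)$, with $\|\beta'\|^2/n=r^2$ almost surely (for all large $n$), and $\varepsilon$ has i.i.d. $N(0,\sigma^2)$ entries and is independent of $(Q,D,O,\beta')$. Write $d_i^2=(D^\top D)_{ii}$ and $\mathcal N=\{i:d_i^2>0\}$. Assume that, almost surely, $\liminf_n d_i^2>0$ for every $i\in\mathcal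 J_a$, and $\liminf_n\frac1n\sum_{i\in\mathcal N}(d_i^2-\bar d)^2>0$, where $\bar d$ is the average of $d_i^2$ over $i\in\mathcal N$. *Estimators.* For a set $S$ of indices let $O_S$ be the matrix of the rows $o_i$, $i\in S$, let $D_S$ be the matrix of the columns of $D$ indexed by $S$, and let $X_S=XO_S^\top$. Put $$\hat\alpha=\tfrac1{\sqrt n}(X_{\mathcal J_a}^\top X_{\mathcal J_a})^{-1}X_{\mathcal J_a}^\top y .$$ With $S=\mathcal N\setminus\mathcal J_a$ and $k=|S|$, the reduced model is $$X_{\rm new}=(D_S^\top D_S)^{1/2}O_S\in\mathbb R^{k\times p},\qquad y_{\rm new}=(D_S^\top D_S)^{1/2}(X_S^\top X_S)^{-1}X_S^\top y\in\mathbb R^k .$$ Fix $\lambda_1,\dots,\lambda_L>0$, not all equal. Let $v(z)=\int (x-z)^{-1}\,d\mu(x)$ be the Stieltjes transform of the empirical distribution $\mu$ of the eigenvalues of $X_{\rm new}X_{\rm new}^\top$, and for an aspect ratio $g>0$ put $$a_i=\tfrac{\lambda_i^2}{g}\bigl(v(-\lambda_i)-\lambda_i v'(-\lambda_i)\bigr),\quad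 b_i=\lambda_i^2v'(-\lambda_i),\quad t_i=\tfrac1k\|y_{\rm new}-X_{\rm new}\hat\beta_{\lambda_i}\|^2,$$ $$\hat\beta_\lambda=(X_{\rm new}^\top X_{\rm new}+\lambda I)^{-1}X_{\rm new}^\top y_{\rm new},$$ $$\hat\sigma^2_g=\frac{\sum_i\bigl(\frac{t_i}{a_i}-\frac{t_1}{a_1}\bigr)\bigl(\frac{b_i}{a_i}-\frac{b_1}{a_1}\bigr)}{\sum_i\bigl(\frac{b_i}{a_i}-\frac{b_1}{a_1}\bigr)^2},\qquad \hat r^2_g=\frac{\sum_i\bigl(\frac{t_i}{b_i}-\frac{t_1}{b_1}\bigr)\bigl(\frac{a_i}{b_i}-\frac{a_1}{b_1}\bigr)}{\sum_i\bigl(\frac{a_i}{b_i}-\frac{a_1}{b_1}\bigr)^2}.$$ *Lemma.* The estimators are strongly consistent: almost surely, as $n\to\infty$, $\hat\alpha_i\to\alpha_i$ for every $i\in\mathcal J_a$; with the aspect ratio $g=p/n$ of the data, $\hat r^2_g\to r^2$ and $\hat\sigma^2_g\to\sigma^2$; and with the aspect ratio $g=p/k$ of the reduced model, $\hat r^2_g-\|\beta'\|^2/k\to0$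 (the signal strength of the reduced model with its $k$ observations) and $\hat\sigma^2_g\to\sigma^2$. -/

import Mathlib

open MeasureTheory ProbabilityTheory Filter Topology Matrix
open scoped ENNReal NNReal

noncomputable section

namespace RotiGCV

/-- The entrywise (Borel) sigma-algebra on real matrices. -/
instance instMeasurableSpaceRealMatrix {m n : Type*} : MeasurableSpace (Matrix m n ℝ) :=
  MeasurableSpace.pi

/-! ### The random design -/

/-- `O` is a random orthogonal matrix distributed according to the Haar probability measure of the
orthogonal group: its law is the one invariant under left and right multiplication by every
fixed orthogonal matrix. -/
structure IsHaarOrthogonal {Ω : Type*} [MeasurableSpace Ω] (μ : Measure Ω) {p : ℕ}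
    (O : Ω → Matrix (Fin p) (Fin p) ℝ) : Prop where
  measurable : Measurable O
  mem_orthogonal : ∀ ω, O ω ∈ Matrix.orthogonalGroup (Fin p) ℝ
  map_mul_left : ∀ U ∈ Matrix.orthogonalGroup (Fin p) ℝ, μ.map (fun ω => U * O ω) = μ.map O
  map_mul_right : ∀ U ∈ Matrix.orthogonalGroup (Fin p) ℝ, μ.map (fun ω => O ω * U) = μ.map O

/-- `Qᵀ * D * O` is a singular value decomposition of a right-rotationally invariant random
`n × p` design: `Q` is orthogonal, `D` is rectangular diagonal with nonnegative diagonal, and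
`O` is Haar distributed and independent of `(Q, D)`. The singular values need not be sorted. -/
structure IsRightRotInvariant {Ω : Type*} [MeasurableSpace Ω] (μ : Measure Ω) {n p : ℕ}
    (Q : Ω → Matrix (Fin n) (Fin n) ℝ) (D : Ω → Matrix (Fin n) (Fin p) ℝ)
    (O : Ω → Matrix (Fin p) (Fin p) ℝ) : Prop where
  measurable_left : Measurable Q
  left_orthogonal : ∀ ω, Q ω ∈ Matrix.orthogonalGroup (Fin n) ℝ
  measurable_diag : Measurable D
  diag_nonneg : ∀ ω i j, 0 ≤ D ω i j
  diag_off : ∀ ω (i : Fin n) (j : Fin p), i.val ≠ j.val → D ω i j = 0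
  haar : IsHaarOrthogonal μ O
  indep : IndepFun O (fun ω => (Q ω, D ω)) μ

/-- The design matrix `X = Qᵀ D O`. -/
def design {n p : ℕ} (Q : Matrix (Fin n) (Fin n) ℝ) (D : Matrix (Fin n) (Fin p) ℝ)
    (O : Matrix (Fin p) (Fin p) ℝ) : Matrix (Fin n) (Fin p) ℝ :=
  Qᵀ * D * O

/-- The positions in `Fin p` of the indices in `J`. -/
def positions (p : ℕ) (J : Finset ℕ) : Finset (Fin p) :=
  Finset.univ.filter fun i => i.val ∈ J

/-- The aligned signal `β = β' + ∑_{i ∈ J} √n α_i o_i`, where `o_i` is the `i`-th row of `O`. -/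
def alignedSignal (n : ℕ) {p : ℕ} (J : Finset ℕ) (α : ℕ → ℝ) (O : Matrix (Fin p) (Fin p) ℝ)
    (β' : Fin p → ℝ) : Fin p → ℝ :=
  β' + ∑ i ∈ positions p J, (Real.sqrt n * α i.val) • O i

/-- The response `y = X β + ε` for the aligned signal `β`. -/
def response {n p : ℕ} (J : Finset ℕ) (α : ℕ → ℝ) (Q : Matrix (Fin n) (Fin n) ℝ)
    (D : Matrix (Fin n) (Fin p) ℝ) (O : Matrix (Fin p) (Fin p) ℝ) (β' : Fin p → ℝ)
    (ε : Fin n → ℝ) : Fin n → ℝ :=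
  design Q D O *ᵥ alignedSignal n J α O β' + ε

/-- The set `{i : (Dᵀ D)_ii > 0}` of indices of nonzero singular values. -/
def nonzeroIndices {n p : ℕ} (D : Matrix (Fin n) (Fin p) ℝ) : Finset (Fin p) :=
  Finset.univ.filter fun i => 0 < (Dᵀ * D) i i

/-- The average of the nonzero squared singular values. -/
def meanNonzeroSq {n p : ℕ} (D : Matrix (Fin n) (Fin p) ℝ) : ℝ :=
  (∑ i ∈ nonzeroIndices D, (Dᵀ * D) i i) / (nonzeroIndices D).card

/-- The spread `(1/n) ∑ (d_i² - mean)²` of the nonzero squared singular values. -/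
def spectralSpread {n p : ℕ} (D : Matrix (Fin n) (Fin p) ℝ) : ℝ :=
  (∑ i ∈ nonzeroIndices D, ((Dᵀ * D) i i - meanNonzeroSq D) ^ 2) / n

/-! ### The estimators of ROTI-GCV for a general design `X` (rows indexed by `ι`) -/

/-- The Stieltjes transform `m(μ, z) = ∫ 1 / (x - z) dμ(x)` at a real point `z`. -/
def stieltjes (μ : Measure ℝ) (z : ℝ) : ℝ := ∫ x, (x - z)⁻¹ ∂μ

/-- The empirical distribution of the eigenvalues of `X Xᵀ`. -/
def companionMeasure {ι κ : Type*} [Fintype ι] [DecidableEq ι] [Fintype κ] (X : Matrix ι κ ℝ) :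
    Measure ℝ :=
  (Fintype.card ι : ℝ≥0∞)⁻¹ •
    ∑ i, Measure.dirac ((Matrix.isHermitian_mul_conjTranspose_self X).eigenvalues i)

/-- The companion Stieltjes transform `v`. -/
def companion {ι κ : Type*} [Fintype ι] [DecidableEq ι] [Fintype κ] (X : Matrix ι κ ℝ) (z : ℝ) :
    ℝ :=
  stieltjes (companionMeasure X) z

/-- `a(λ) = (λ² / γ) (v(-λ) - λ v'(-λ))`, for the aspect ratio `γ`. -/
def coeffA {ι κ : Type*} [Fintype ι] [DecidableEq ι] [Fintype κ] (γ : ℝ) (X : Matrix ι κ ℝ)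
    (l : ℝ) : ℝ :=
  l ^ 2 / γ * (companion X (-l) - l * deriv (companion X) (-l))

/-- `b(λ) = λ² v'(-λ)`. -/
def coeffB {ι κ : Type*} [Fintype ι] [DecidableEq ι] [Fintype κ] (X : Matrix ι κ ℝ) (l : ℝ) : ℝ :=
  l ^ 2 * deriv (companion X) (-l)

/-- The ridge estimator `(Xᵀ X + λ I)⁻¹ Xᵀ y`. -/
def ridge {ι κ : Type*} [Fintype ι] [Fintype κ] [DecidableEq κ] (X : Matrix ι κ ℝ) (y : ι → ℝ)
    (l : ℝ) : κ → ℝ :=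
  (Xᵀ * X + l • (1 : Matrix κ κ ℝ))⁻¹ *ᵥ (Xᵀ *ᵥ y)

/-- The training error `t(λ) = ‖y - X β̂_λ‖² / (sample size)` of the ridge estimator. -/
def trainError {ι κ : Type*} [Fintype ι] [Fintype κ] [DecidableEq κ] (X : Matrix ι κ ℝ)
    (y : ι → ℝ) (l : ℝ) : ℝ :=
  (∑ i, (y i - (X *ᵥ ridge X y l) i) ^ 2) / Fintype.card ι

/-- The estimator `σ̂²` for the grid `lam 0, …, lam L`. -/
def sigmaSqHat {ι κ : Type*} [Fintype ι] [DecidableEq ι] [Fintype κ] [DecidableEq κ] {L : ℕ}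
    (γ : ℝ) (lam : Fin (L + 1) → ℝ) (X : Matrix ι κ ℝ) (y : ι → ℝ) : ℝ :=
  let a := fun i => coeffA γ X (lam i)
  let b := fun i => coeffB X (lam i)
  let t := fun i => trainError X y (lam i)
  (∑ i, (t i / a i - t 0 / a 0) * (b i / a i - b 0 / a 0)) / ∑ i, (b i / a i - b 0 / a 0) ^ 2

/-- The estimator `r̂²` for the grid `lam 0, …, lam L`. -/
def rSqHat {ι κ : Type*} [Fintype ι] [DecidableEq ι] [Fintype κ] [DecidableEq κ] {L : ℕ}
    (γ : ℝ) (lam : Fin (L + 1) → ℝ) (X : Matrix ι κ ℝ) (y : ι → ℝ) : ℝ :=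
  let a := fun i => coeffA γ X (lam i)
  let b := fun i => coeffB X (lam i)
  let t := fun i => trainError X y (lam i)
  (∑ i, (t i / b i - t 0 / b 0) * (a i / b i - a 0 / b 0)) / ∑ i, (a i / b i - a 0 / b 0) ^ 2

/-! ### Principal components regression and the reduced model

Both are computed from the data `X`, `y` and from the factors `D`, `O` of the decomposition. -/

/-- The rows of `O` indexed by `S`. -/
def rowsOf {p : ℕ} (O : Matrix (Fin p) (Fin p) ℝ) (S : Finset (Fin p)) : Matrix S (Fin p) ℝ :=
  O.submatrix Subtype.val id

/-- `(X_Sᵀ X_S)⁻¹ X_Sᵀ y` for `X_S = X O_Sᵀ`: the regression of `y` on the principal components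
indexed by `S`. -/
def pcRegression {n p : ℕ} (X : Matrix (Fin n) (Fin p) ℝ) (O : Matrix (Fin p) (Fin p) ℝ)
    (S : Finset (Fin p)) (y : Fin n → ℝ) : S → ℝ :=
  let XS : Matrix (Fin n) S ℝ := X * (rowsOf O S)ᵀ
  (XSᵀ * XS)⁻¹ *ᵥ (XSᵀ *ᵥ y)

/-- The coordinate `α̂_i` of the estimate of `α`: the principal-components-regression coefficient
of the `i`-th component among those in `J`, on the scale `√n` of the signal
(and `0` if `i` is not the index of such a component). -/
def alphaHat {n p : ℕ} (X : Matrix (Fin n) (Fin p) ℝ) (O : Matrix (Fin p) (Fin p) ℝ)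
    (J : Finset ℕ) (y : Fin n → ℝ) (i : ℕ) : ℝ :=
  if h : ∃ j : Fin p, j ∈ positions p J ∧ j.val = i then
    pcRegression X O (positions p J) y ⟨h.choose, h.choose_spec.1⟩ / Real.sqrt n
  else 0

/-- The complement of `J` among the indices of the nonzero singular values. -/
def residualIndices {n p : ℕ} (D : Matrix (Fin n) (Fin p) ℝ) (J : Finset ℕ) : Finset (Fin p) :=
  nonzeroIndices D \ positions p J

/-- The matrix `(D_Sᵀ D_S)^{1/2}`, where `D_S` consists of the columns of `D` indexed by `S`; as
`D_Sᵀ D_S` is diagonal, the root is taken entrywise on the diagonal. -/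
def sqrtGram {n p : ℕ} (D : Matrix (Fin n) (Fin p) ℝ) (S : Finset (Fin p)) : Matrix S S ℝ :=
  Matrix.diagonal fun j => Real.sqrt ((Dᵀ * D) j.val j.val)

/-- The design `X_new = (D_Sᵀ D_S)^{1/2} O_S` of the reduced model. -/
def reducedDesign {n p : ℕ} (D : Matrix (Fin n) (Fin p) ℝ) (O : Matrix (Fin p) (Fin p) ℝ)
    (S : Finset (Fin p)) : Matrix S (Fin p) ℝ :=
  sqrtGram D S * rowsOf O S

/-- The response `y_new = (D_Sᵀ D_S)^{1/2} (X_Sᵀ X_S)⁻¹ X_Sᵀ y` of the reduced model. -/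
def reducedResponse {n p : ℕ} (X : Matrix (Fin n) (Fin p) ℝ) (D : Matrix (Fin n) (Fin p) ℝ)
    (O : Matrix (Fin p) (Fin p) ℝ) (S : Finset (Fin p)) (y : Fin n → ℝ) : S → ℝ :=
  sqrtGram D S *ᵥ pcRegression X O S y

/-- `σ̂²` computed from the reduced model of the data `X`, `y`. -/
def reducedSigmaSqHat {n p L : ℕ} (γ : ℝ) (lam : Fin (L + 1) → ℝ) (J : Finset ℕ)
    (X : Matrix (Fin n) (Fin p) ℝ) (D : Matrix (Fin n) (Fin p) ℝ)
    (O : Matrix (Fin p) (Fin p) ℝ) (y : Fin n → ℝ) : ℝ :=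
  sigmaSqHat γ lam (reducedDesign D O (residualIndices D J)) (reducedResponse X D O (residualIndices D J) y)

/-- `r̂²` computed from the reduced model of the data `X`, `y`. -/
def reducedRSqHat {n p L : ℕ} (γ : ℝ) (lam : Fin (L + 1) → ℝ) (J : Finset ℕ)
    (X : Matrix (Fin n) (Fin p) ℝ) (D : Matrix (Fin n) (Fin p) ℝ)
    (O : Matrix (Fin p) (Fin p) ℝ) (y : Fin n → ℝ) : ℝ :=
  rSqHat γ lam (reducedDesign D O (residualIndices D J)) (reducedResponse X D O (residualIndices D J) y)

end RotiGCV

end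

open RotiGCV

noncomputable section

namespace RotiGCV

/-! ### Fourth moments -/

/-! In the coordinates given by `O` the problem is diagonal. Regressing on principal components
returns, in coordinate j, w_j + ζ_j / d_j² plus √n α_j if j is aligned, where w = Oβ' and ζ = Dᵀ(Qε)
(`pcRegression_design_response`). The reduced design has orthogonal rows of squared length d_j², so
a, b and the ridge training error t are explicit averages over the k residual indices: of
d²/(d²+λ)², of 1/(d²+λ)², and of y_new² weighted by 1/(d²+λ)².

A Haar rotation spreads the signal evenly, so w_j² averages to s = r² n/p, while ζ_j² averages to σ²
d_j². Hence t = (s g) a + σ² b + e for every aspect ratio g (`trainError_sum_eq`). The error e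
collects three fluctuations: a quadratic form in w, a linear form in ε, and a quadratic form in Qε.
After division by n each has fourth moment O(1/n²), so it tends to 0 almost surely
(`tendsto_zero_of_lintegral_pow_four_le`). For the Gaussian forms this is a direct moment
computation. The Haar form is reduced to it by homogeneity and by comparison with a Gaussian vector
(`exists_haar_quadratic_pow_four_le`).

Regression over the grid recovers both coefficients as soon as the vectors (a_i, b_i) stay bounded
and uniformly non-collinear (`tendsto_grid_regression`). The 2 × 2 determinant, symmetrised over
pairs of indices, is bounded below by a multiple of ∑ (d_i² - d_j²)² (`sum_sub_sq_mul_le`). Deleting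
the finitely many aligned indices leaves enough of this spread (`spread_subset`). The limit s g
equals r² for g = p/n and r² n/k = ‖β'‖²/k for g = p/k.

For α̂ the error in coordinate i is w_i/√n + ζ_i/(d_i²√n). The same concentration results, applied
to an indicator weight and to a single normalised component, make both terms vanish
(`tendsto_alphaHat`). -/

theorem integrable_pow_of_memLp_four {Ω : Type*} [MeasurableSpace Ω] {μ : Measure Ω}
    [IsFiniteMeasure μ] {f : Ω → ℝ} (hf : MemLp f 4 μ) {k : ℕ} (hk : k ≤ 4) :
    Integrable (fun ω => f ω ^ k) μ := by
  rcases Nat.eq_zero_or_pos k with rfl | h0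
  · simp
  have h1 : MemLp f (k : ℝ≥0∞) μ := hf.mono_exponent (by exact_mod_cast hk)
  have h2 := h1.integrable_norm_pow h0.ne'
  refine (integrable_norm_iff (hf.aestronglyMeasurable.pow k)).1 ?_
  simpa [norm_pow] using h2

/-- Second and fourth moments of a weighted sum of independent centred variables. -/
theorem moments_sum_le {Ω ι : Type*} [MeasurableSpace Ω] {μ : Measure Ω}
    [IsProbabilityMeasure μ] {Z : ι → Ω → ℝ} (hm : ∀ i, Measurable (Z i)) (hZ : iIndepFun Z μ)
    (h4 : ∀ i, MemLp (Z i) 4 μ) (h0 : ∀ i, ∫ ω, Z i ω ∂μ = 0) {M : ℝ}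
    (hM2 : ∀ i, ∫ ω, Z i ω ^ 2 ∂μ ≤ M) (hM4 : ∀ i, ∫ ω, Z i ω ^ 4 ∂μ ≤ M ^ 2)
    (c : ι → ℝ) (s : Finset ι) :
    MemLp (fun ω => ∑ i ∈ s, c i * Z i ω) 4 μ ∧ ∫ ω, ∑ i ∈ s, c i * Z i ω ∂μ = 0 ∧
      ∫ ω, (∑ i ∈ s, c i * Z i ω) ^ 2 ∂μ ≤ M * ∑ i ∈ s, c i ^ 2 ∧
      ∫ ω, (∑ i ∈ s, c i * Z i ω) ^ 4 ∂μ ≤ 3 * M ^ 2 * (∑ i ∈ s, c i ^ 2) ^ 2 := by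
  classical
  induction s using Finset.induction_on with
  | empty => simp
  | insert a s ha ih =>
    obtain ⟨hS, hS0, hS2, hS4⟩ := ih
    set S : Ω → ℝ := fun ω => ∑ i ∈ s, c i * Z i ω with hSdef
    have hW : MemLp (fun ω => c a * Z a ω) 4 μ := (h4 a).const_mul _
    set W : Ω → ℝ := fun ω => c a * Z a ω with hWdef
    have hind : IndepFun S W μ := by
      have h := (hZ.comp (fun i x => c i * x) (fun i => measurable_const_mul _))
      have h' := h.indepFun_finsetSum_of_notMem
        (fun i => (measurable_const_mul _).comp (hm i)) ha
      convert h' using 1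
      · ext ω; simp [hSdef]
      · rfl
    have hSW : ∀ k l : ℕ, k ≤ 4 → l ≤ 4 → Integrable (fun ω => S ω ^ k * W ω ^ l) μ ∧
        ∫ ω, S ω ^ k * W ω ^ l ∂μ = (∫ ω, S ω ^ k ∂μ) * ∫ ω, W ω ^ l ∂μ := by
      intro k l hk hl
      have hi := hind.comp (measurable_id.pow_const k) (measurable_id.pow_const l)
      exact ⟨hi.integrable_mul (integrable_pow_of_memLp_four hS hk)
          (integrable_pow_of_memLp_four hW hl),
        hi.integral_mul_eq_mul_integral (integrable_pow_of_memLp_four hS hk).aestronglyMeasurable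
          (integrable_pow_of_memLp_four hW hl).aestronglyMeasurable⟩
    have hW0 : ∫ ω, W ω ∂μ = 0 := by simp [hWdef, integral_const_mul, h0]
    have hW2 : ∫ ω, W ω ^ 2 ∂μ ≤ M * c a ^ 2 := by
      simp only [hWdef, mul_pow, integral_const_mul]
      nlinarith [hM2 a, sq_nonneg (c a)]
    have hW4 : ∫ ω, W ω ^ 4 ∂μ ≤ M ^ 2 * c a ^ 4 := by
      simp only [hWdef, mul_pow, integral_const_mul]
      nlinarith [hM4 a, show 0 ≤ c a ^ 4 by positivity]
    have hM : 0 ≤ M := (integral_nonneg fun ω => sq_nonneg _).trans (hM2 a)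
    have hW2' : 0 ≤ ∫ ω, W ω ^ 2 ∂μ := integral_nonneg fun ω => sq_nonneg _
    have hS2' : 0 ≤ ∫ ω, S ω ^ 2 ∂μ := integral_nonneg fun ω => sq_nonneg _
    have hsum : ∀ ω, ∑ i ∈ insert a s, c i * Z i ω = S ω + W ω := by
      intro ω; rw [Finset.sum_insert ha, add_comm]
    simp_rw [hsum, Finset.sum_insert ha]
    set V := ∑ i ∈ s, c i ^ 2
    have hV : 0 ≤ V := Finset.sum_nonneg fun i _ => sq_nonneg _
    have i1 := hSW 1 1 (by norm_num) (by norm_num)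
    have i2 := hSW 3 1 (by norm_num) (by norm_num)
    have i3 := hSW 2 2 (by norm_num) (by norm_num)
    have i4 := hSW 1 3 (by norm_num) (by norm_num)
    have iS := fun k (hk : k ≤ 4) => integrable_pow_of_memLp_four hS hk
    have iW := fun k (hk : k ≤ 4) => integrable_pow_of_memLp_four hW hk
    refine ⟨hS.add hW, ?_, ?_, ?_⟩
    · rw [integral_add (by simpa using iS 1 (by norm_num)) (by simpa using iW 1 (by norm_num)),
        hS0, hW0, add_zero]
    · have : ∀ ω, (S ω + W ω) ^ 2 = S ω ^ 2 + 2 * (S ω ^ 1 * W ω ^ 1) + W ω ^ 2 :=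
        fun ω => by ring
      simp_rw [this]
      rw [integral_add _ (iW 2 (by norm_num)),
        integral_add (iS 2 (by norm_num)) (i1.1.const_mul _), integral_const_mul, i1.2]
      · simp only [pow_one, hS0, hW0]
        linarith
      · exact (iS 2 (by norm_num)).add (i1.1.const_mul _)
    -- The odd mixed terms vanish because S and W are centred and independent. The rest is at most
    -- M²(3V² + 6V c_a² + c_a⁴), which is below 3M²(V + c_a²)².
    · have : ∀ ω, (S ω + W ω) ^ 4 = S ω ^ 4 + 4 * (S ω ^ 3 * W ω ^ 1) +
          6 * (S ω ^ 2 * W ω ^ 2) + 4 * (S ω ^ 1 * W ω ^ 3) + W ω ^ 4 := fun ω => by ring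
      simp_rw [this]
      rw [integral_add _ (iW 4 le_rfl), integral_add _ (i4.1.const_mul _),
        integral_add _ (i3.1.const_mul _), integral_add (iS 4 le_rfl) (i2.1.const_mul _),
        integral_const_mul, integral_const_mul, integral_const_mul, i2.2, i3.2, i4.2]
      · simp only [pow_one, hS0, hW0]
        have := mul_le_mul hS2 hW2 hW2' (by positivity)
        nlinarith [mul_nonneg (sq_nonneg M) (show 0 ≤ c a ^ 4 by positivity)]
      · exact (iS 4 le_rfl).add (i2.1.const_mul _)
      · exact ((iS 4 le_rfl).add (i2.1.const_mul _)).add (i3.1.const_mul _)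
      · exact (((iS 4 le_rfl).add (i2.1.const_mul _)).add (i3.1.const_mul _)).add
          (i4.1.const_mul _)

/-- The fourth moment of a weighted sum of centred functions of i.i.d. coordinates. -/
theorem exists_lintegral_pi_sum_pow_four_le (ν : Measure ℝ) [IsProbabilityMeasure ν]
    (h : ℝ → ℝ) (hm : Measurable h) (h4 : MemLp h 4 ν) (h0 : ∫ x, h x ∂ν = 0) :
    ∃ K : ℝ, 0 ≤ K ∧ ∀ (n : ℕ) (c : Fin n → ℝ),
      ∫⁻ x, ENNReal.ofReal ((∑ i, c i * h (x i)) ^ 4) ∂(Measure.pi fun _ : Fin n => ν)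
        ≤ ENNReal.ofReal (K * (∑ i, c i ^ 2) ^ 2) := by
  -- With this sum, M dominates the second moment and M² the fourth.
  set M : ℝ := ∫ x, h x ^ 2 ∂ν + Real.sqrt (∫ x, h x ^ 4 ∂ν)
  have e2 : 0 ≤ ∫ x, h x ^ 2 ∂ν := integral_nonneg fun x => sq_nonneg _
  have e4 : 0 ≤ ∫ x, h x ^ 4 ∂ν := integral_nonneg fun x => by positivity
  refine ⟨3 * M ^ 2, by positivity, fun n c => ?_⟩
  have hmp : ∀ i, MeasurePreserving (Function.eval i) (Measure.pi fun _ : Fin n => ν) ν :=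
    fun i => measurePreserving_eval _ i
  have hint : ∀ i (f : ℝ → ℝ), Measurable f →
      ∫ x, f (x i) ∂(Measure.pi fun _ : Fin n => ν) = ∫ x, f x ∂ν := by
    intro i f hf
    conv_rhs => rw [← (hmp i).map_eq]
    rw [integral_map (measurable_pi_apply i).aemeasurable hf.aestronglyMeasurable]
  have hind : iIndepFun (fun i (x : Fin n → ℝ) => h (x i)) (Measure.pi fun _ : Fin n => ν) :=
    iIndepFun_pi (X := fun _ : Fin n => h) fun _ => hm.aemeasurable
  obtain ⟨hS, -, -, hS4⟩ := moments_sum_le (M := M)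
    (Z := fun i (x : Fin n → ℝ) => h (x i)) (fun i => hm.comp (measurable_pi_apply i)) hind
    (fun i => h4.comp_measurePreserving (hmp i)) (fun i => (hint i h hm).trans h0)
    (fun i => by
      rw [hint i (fun x => h x ^ 2) (hm.pow_const 2)]
      exact le_add_of_nonneg_right (Real.sqrt_nonneg _))
    (fun i => by
      rw [hint i (fun x => h x ^ 4) (hm.pow_const 4)]
      nlinarith [Real.sq_sqrt e4, Real.sqrt_nonneg (∫ x, h x ^ 4 ∂ν)]) c Finset.univ
  rw [← ofReal_integral_eq_lintegral_ofReal (integrable_pow_of_memLp_four hS le_rfl)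
    (ae_of_all _ fun x => by positivity)]
  exact ENNReal.ofReal_le_ofReal hS4

/-! ### The standard Gaussian vector -/

/-- The law of a centred Gaussian vector with covariance `v • 1` is rotation invariant. -/
theorem map_mulVec_pi_gaussianReal {n : ℕ} (v : ℝ≥0) {U : Matrix (Fin n) (Fin n) ℝ}
    (hU : U ∈ Matrix.orthogonalGroup (Fin n) ℝ) :
    (Measure.pi fun _ : Fin n => gaussianReal 0 v).map (fun x => U *ᵥ x) =
      Measure.pi fun _ => gaussianReal 0 v := by
  have hUm : Measurable fun x : Fin n → ℝ => U *ᵥ x := by fun_prop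
  have hl : Measurable (WithLp.toLp 2 : (Fin n → ℝ) → EuclideanSpace ℝ (Fin n)) := by fun_prop
  have hl' : Measurable (WithLp.ofLp : EuclideanSpace ℝ (Fin n) → (Fin n → ℝ)) := by fun_prop
  -- Characteristic functions need the inner product of `EuclideanSpace`. Rotating the vector by U
  -- moves the argument t to Uᵀt, and the Gaussian one depends only on |t|.
  have key : ((Measure.pi fun _ : Fin n => gaussianReal 0 v).map (fun x => U *ᵥ x)).map
      (WithLp.toLp 2) = (Measure.pi fun _ : Fin n => gaussianReal 0 v).map (WithLp.toLp 2) := by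
    have : IsProbabilityMeasure ((Measure.pi fun _ : Fin n => gaussianReal 0 v).map
      (fun x => U *ᵥ x)) := Measure.isProbabilityMeasure_map hUm.aemeasurable
    apply Measure.ext_of_charFun (E := EuclideanSpace ℝ (Fin n))
    ext t
    have h1 : charFun (((Measure.pi fun _ : Fin n => gaussianReal 0 v).map
        (fun x => U *ᵥ x)).map (WithLp.toLp 2)) t =
        charFun ((Measure.pi fun _ : Fin n => gaussianReal 0 v).map (WithLp.toLp 2))
          (WithLp.toLp 2 (Uᵀ *ᵥ t.ofLp)) := by
      rw [charFun_apply, charFun_apply, integral_map hl.aemeasurable, integral_map hUm.aemeasurable,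
        integral_map hl.aemeasurable]
      · congr 1; ext x
        congr 3
        simp only [EuclideanSpace.inner_eq_star_dotProduct, star_trivial]
        rw [dotProduct_mulVec, Matrix.mulVec_transpose]
      all_goals exact Measurable.aestronglyMeasurable (by fun_prop)
    rw [h1, charFun_pi, charFun_pi]
    simp only [charFun_gaussianReal, ← Complex.exp_sum]
    congr 1
    have h2 : ∑ i, (Uᵀ *ᵥ t.ofLp) i ^ 2 = ∑ i, t i ^ 2 := by
      have : (Uᵀ *ᵥ t.ofLp) ⬝ᵥ (Uᵀ *ᵥ t.ofLp) = t.ofLp ⬝ᵥ t.ofLp := by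
        rw [Matrix.dotProduct_mulVec, Matrix.vecMul_transpose, Matrix.mulVec_mulVec]
        have := (Matrix.mem_orthogonalGroup_iff (Fin n) ℝ).1 hU
        rw [this, Matrix.one_mulVec]
      simpa [dotProduct, sq] using this
    have h3 : ∑ i, (((Uᵀ *ᵥ t.ofLp) i : ℝ) : ℂ) ^ 2 = ∑ i, ((t i : ℝ) : ℂ) ^ 2 := by
      exact_mod_cast h2
    simp only [Complex.ofReal_zero, mul_zero, zero_mul, zero_sub, Finset.sum_neg_distrib,
      ← Finset.sum_div, ← Finset.mul_sum]
    rw [h3]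
  have := congrArg (Measure.map WithLp.ofLp) key
  rwa [Measure.map_map hl' hl, Measure.map_map hl' hl,
    show (WithLp.ofLp ∘ WithLp.toLp 2 : (Fin n → ℝ) → (Fin n → ℝ)) = id from rfl,
    Measure.map_id, Measure.map_id] at this

theorem memLp_gaussianReal_linear (v : ℝ≥0) : MemLp (fun x : ℝ => x) 4 (gaussianReal 0 v) :=
  memLp_id_gaussianReal' 4 (by norm_num)

theorem integral_sq_gaussianReal (v : ℝ≥0) : ∫ x, x ^ 2 ∂gaussianReal 0 v = v := by
  have h := variance_of_integral_eq_zero (X := fun x : ℝ => x) (μ := gaussianReal 0 v)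
    aemeasurable_id (by simp)
  rw [variance_fun_id_gaussianReal] at h
  simpa using h.symm

theorem memLp_gaussianReal_sq_sub (v : ℝ≥0) :
    MemLp (fun x : ℝ => x ^ 2 - v) 4 (gaussianReal 0 v) := by
  refine MemLp.sub ?_ (memLp_const _)
  have h : MemLp (fun x : ℝ => x) 8 (gaussianReal 0 v) := memLp_id_gaussianReal' 8 (by norm_num)
  have := h.mul (p := 8) (q := 8) (r := 4) h (hpqr := ⟨by
    rw [← two_mul, show (8 : ℝ≥0∞) = 2 * 4 by norm_num,
      ENNReal.mul_inv (by norm_num) (by norm_num), ← mul_assoc,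
      ENNReal.mul_inv_cancel (by norm_num) (by norm_num), one_mul]⟩)
  simpa [sq, Pi.mul_def] using this

theorem integral_sq_sub_gaussianReal (v : ℝ≥0) :
    ∫ x, (x ^ 2 - (v : ℝ)) ∂gaussianReal 0 v = 0 := by
  rw [integral_sub _ (integrable_const _), integral_sq_gaussianReal]
  · simp
  · exact integrable_pow_of_memLp_four (memLp_gaussianReal_linear v) (by norm_num)

/-! ### Measurability of matrix operations -/

theorem measurable_matrix_entry {Ω m n : Type*} [MeasurableSpace Ω] {A : Ω → Matrix m n ℝ}
    (hA : Measurable A) (i : m) (j : n) : Measurable fun ω => A ω i j :=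
  measurable_pi_iff.1 (measurable_pi_iff.1 hA i) j

theorem measurable_mulVec {Ω m n : Type*} [MeasurableSpace Ω] [Fintype n] {A : Ω → Matrix m n ℝ}
    {x : Ω → n → ℝ} (hA : Measurable A) (hx : Measurable x) : Measurable fun ω => A ω *ᵥ x ω := by
  refine measurable_pi_iff.2 fun i => ?_
  simp only [Matrix.mulVec, dotProduct]
  exact Finset.measurable_sum _ fun j _ =>
    (measurable_matrix_entry hA i j).mul (measurable_pi_iff.1 hx j)

theorem measurable_matrix_mul {Ω l m n : Type*} [MeasurableSpace Ω] [Fintype m]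
    {A : Ω → Matrix l m ℝ} {B : Ω → Matrix m n ℝ} (hA : Measurable A) (hB : Measurable B) :
    Measurable fun ω => A ω * B ω := by
  refine measurable_pi_iff.2 fun i => measurable_pi_iff.2 fun j => ?_
  simp only [Matrix.mul_apply]
  exact Finset.measurable_sum _ fun k _ =>
    (measurable_matrix_entry hA i k).mul (measurable_matrix_entry hB k j)

theorem measurable_matrix_transpose {Ω m n : Type*} [MeasurableSpace Ω] {A : Ω → Matrix m n ℝ}
    (hA : Measurable A) : Measurable fun ω => (A ω)ᵀ :=
  measurable_pi_iff.2 fun i => measurable_pi_iff.2 fun j => measurable_matrix_entry hA j i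

/-! ### Haar orthogonal matrices applied to a fixed vector -/

theorem sum_sq_eq_dotProduct {ι : Type*} [Fintype ι] (x : ι → ℝ) : ∑ i, x i ^ 2 = x ⬝ᵥ x := by
  simp [dotProduct, sq]

theorem transpose_mul_self_of_mem_orthogonal {p : ℕ} {U : Matrix (Fin p) (Fin p) ℝ}
    (hU : U ∈ Matrix.orthogonalGroup (Fin p) ℝ) : Uᵀ * U = 1 :=
  (Matrix.mem_orthogonalGroup_iff' (Fin p) ℝ).1 hU

theorem sum_sq_mulVec_of_mem_orthogonal {p : ℕ} {U : Matrix (Fin p) (Fin p) ℝ}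
    (hU : U ∈ Matrix.orthogonalGroup (Fin p) ℝ) (x : Fin p → ℝ) :
    ∑ i, (U *ᵥ x) i ^ 2 = ∑ i, x i ^ 2 := by
  rw [sum_sq_eq_dotProduct, sum_sq_eq_dotProduct, Matrix.dotProduct_mulVec,
    ← Matrix.mulVec_transpose, Matrix.mulVec_mulVec, transpose_mul_self_of_mem_orthogonal hU,
    Matrix.one_mulVec]

/-- Vectors of the same length are exchanged by a Householder reflection. -/
theorem exists_orthogonal_mulVec_eq {p : ℕ} {x y : Fin p → ℝ} (h : ∑ i, x i ^ 2 = ∑ i, y i ^ 2) :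
    ∃ U ∈ Matrix.orthogonalGroup (Fin p) ℝ, U *ᵥ x = y := by
  rw [sum_sq_eq_dotProduct, sum_sq_eq_dotProduct] at h
  set z := x - y with hz
  by_cases hz0 : z = 0
  · exact ⟨1, one_mem _, by rw [Matrix.one_mulVec]; exact sub_eq_zero.1 hz0⟩
  have hq : z ⬝ᵥ z ≠ 0 := by simpa using hz0
  -- This is where equal lengths enter: the reflection in the hyperplane orthogonal to z then sends
  -- x to x - z = y.
  have hzz : z ⬝ᵥ z = 2 * (z ⬝ᵥ x) := by
    simp only [hz, sub_dotProduct, dotProduct_sub, dotProduct_comm y x]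
    linarith
  refine ⟨1 - (2 / (z ⬝ᵥ z)) • Matrix.vecMulVec z z, ?_, ?_⟩
  · rw [Matrix.mem_orthogonalGroup_iff]
    have ht : (1 - (2 / (z ⬝ᵥ z)) • Matrix.vecMulVec z z)ᵀ =
        1 - (2 / (z ⬝ᵥ z)) • Matrix.vecMulVec z z := by
      simp [Matrix.transpose_sub, Matrix.transpose_smul, Matrix.transpose_vecMulVec]
    have hv : Matrix.vecMulVec z z * Matrix.vecMulVec z z = (z ⬝ᵥ z) • Matrix.vecMulVec z z := by
      ext i j
      simp only [Matrix.mul_apply, Matrix.vecMulVec_apply, Matrix.smul_apply, smul_eq_mul,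
        dotProduct, Finset.sum_mul]
      exact Finset.sum_congr rfl fun k _ => by ring
    change _ * (_)ᵀ = (1 : Matrix (Fin p) (Fin p) ℝ)
    rw [ht, sub_mul, mul_sub, mul_sub, one_mul, one_mul, mul_one, Matrix.smul_mul, Matrix.mul_smul,
      hv, smul_smul, smul_smul]
    have : 2 / (z ⬝ᵥ z) * (2 / (z ⬝ᵥ z)) * (z ⬝ᵥ z) = 2 / (z ⬝ᵥ z) + 2 / (z ⬝ᵥ z) := by
      field_simp; norm_num
    rw [this, add_smul]
    abel
  · rw [Matrix.sub_mulVec, Matrix.one_mulVec, Matrix.smul_mulVec, Matrix.vecMulVec_mulVec]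
    ext i
    have h0 : z ⬝ᵥ x ≠ 0 := fun h0 => hq (by rw [hzz, h0, mul_zero])
    have h1 : 2 / (z ⬝ᵥ z) * (z i * (z ⬝ᵥ x)) = z i := by
      rw [hzz]; field_simp
    have h2 : z i = x i - y i := rfl
    simp only [Pi.sub_apply, Pi.smul_apply, smul_eq_mul, MulOpposite.smul_eq_mul_unop,
      MulOpposite.unop_op]
    rw [h1, h2]
    ring

/-- Right invariance absorbs a fixed rotation of the argument. Combined with Householder
reflections, it makes orbit means depend on x only through its length. -/
theorem IsHaarOrthogonal.lintegral_mulVec_mulVec {Ω : Type*} [MeasurableSpace Ω] {μ : Measure Ω}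
    {p : ℕ} {O : Ω → Matrix (Fin p) (Fin p) ℝ} (hO : IsHaarOrthogonal μ O)
    {U : Matrix (Fin p) (Fin p) ℝ} (hU : U ∈ Matrix.orthogonalGroup (Fin p) ℝ)
    {G : (Fin p → ℝ) → ℝ≥0∞} (hG : Measurable G) (x : Fin p → ℝ) :
    ∫⁻ ω, G (O ω *ᵥ (U *ᵥ x)) ∂μ = ∫⁻ ω, G (O ω *ᵥ x) ∂μ := by
  have hm : Measurable fun A : Matrix (Fin p) (Fin p) ℝ => G (A *ᵥ x) :=
    hG.comp (measurable_mulVec measurable_id measurable_const)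
  have hOm := hO.measurable
  have hOU : Measurable fun ω => O ω * U := measurable_matrix_mul hOm measurable_const
  have h1 := lintegral_map (μ := μ) hm hOU
  have h2 := lintegral_map (μ := μ) hm hOm
  rw [hO.map_mul_right U hU, h2] at h1
  simp_rw [Matrix.mulVec_mulVec]
  exact h1.symm

/-- For a function homogeneous of degree `8`, the mean over the orbit of `b` is determined by the
Gaussian mean. -/
theorem IsHaarOrthogonal.lintegral_mulVec_mul_gaussian {Ω : Type*} [MeasurableSpace Ω]
    {μ : Measure Ω} [IsProbabilityMeasure μ] {p : ℕ} {O : Ω → Matrix (Fin p) (Fin p) ℝ}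
    (hO : IsHaarOrthogonal μ O) {G : (Fin p → ℝ) → ℝ≥0∞} (hG : Measurable G)
    (hhom : ∀ (s : ℝ) w, G (s • w) = ENNReal.ofReal (s ^ 8) * G w) (b : Fin p → ℝ) :
    ENNReal.ofReal ((∑ i, b i ^ 2) ^ 4) *
        ∫⁻ g, G g ∂(Measure.pi fun _ : Fin p => gaussianReal 0 1) =
      (∫⁻ g, ENNReal.ofReal ((∑ i, g i ^ 2) ^ 4) ∂(Measure.pi fun _ : Fin p => gaussianReal 0 1)) *
        ∫⁻ ω, G (O ω *ᵥ b) ∂μ := by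
  have hjoint : Measurable fun q : (Fin p → ℝ) × Ω => G (O q.2 *ᵥ q.1) :=
    hG.comp (measurable_mulVec (hO.measurable.comp measurable_snd) measurable_fst)
  have hm : ∀ b : Fin p → ℝ, Measurable fun ω => G (O ω *ᵥ b) := fun b =>
    hjoint.comp (measurable_const.prodMk measurable_id)
  -- The vectors |b|g and |g|b have equal length, so their orbit means agree; homogeneity extracts
  -- |b|⁸ and |g|⁸. Working without division covers zero vectors too.
  have claim : ∀ g : Fin p → ℝ, ENNReal.ofReal ((∑ i, b i ^ 2) ^ 4) * ∫⁻ ω, G (O ω *ᵥ g) ∂μ =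
      ENNReal.ofReal ((∑ i, g i ^ 2) ^ 4) * ∫⁻ ω, G (O ω *ᵥ b) ∂μ := by
    intro g
    have hb := Real.sq_sqrt (Finset.sum_nonneg fun i (_ : i ∈ Finset.univ) => sq_nonneg (b i))
    have hg := Real.sq_sqrt (Finset.sum_nonneg fun i (_ : i ∈ Finset.univ) => sq_nonneg (g i))
    set sb := Real.sqrt (∑ i, b i ^ 2)
    set sg := Real.sqrt (∑ i, g i ^ 2)
    obtain ⟨U, hU, hUg⟩ := exists_orthogonal_mulVec_eq (x := sb • g) (y := sg • b) (by
      simp only [Pi.smul_apply, smul_eq_mul, mul_pow, ← Finset.mul_sum]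
      rw [hb, hg, mul_comm])
    have h := hO.lintegral_mulVec_mulVec hU hG (sb • g)
    rw [hUg] at h
    simp only [Matrix.mulVec_smul, hhom] at h
    rw [lintegral_const_mul _ (hm _), lintegral_const_mul _ (hm _)] at h
    rw [← hb, ← hg, ← pow_mul, ← pow_mul]
    exact h.symm
  rw [← lintegral_mul_const _ (by fun_prop)]
  simp_rw [← claim]
  have hmi : Measurable fun g : Fin p → ℝ => ∫⁻ ω, G (O ω *ᵥ g) ∂μ := hjoint.lintegral_prod_right'
  rw [lintegral_const_mul _ hmi,
    lintegral_lintegral_swap (f := fun g ω => G (O ω *ᵥ g)) hjoint.aemeasurable]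
  -- After the swap, `O ω` is a fixed rotation of a Gaussian vector and disappears.
  have hin : ∀ ω, ∫⁻ g, G (O ω *ᵥ g) ∂(Measure.pi fun _ : Fin p => gaussianReal 0 1) =
      ∫⁻ g, G g ∂(Measure.pi fun _ : Fin p => gaussianReal 0 1) := by
    intro ω
    conv_rhs => rw [← map_mulVec_pi_gaussianReal 1 (hO.mem_orthogonal ω)]
    rw [lintegral_map hG (by fun_prop)]
  simp_rw [hin]
  simp

/-- Jensen's inequality for x⁴, in the form of the tangent at p: 4p³x ≤ x⁴ + 3p⁴ with x = |g|²,
whose mean is p. It bounds from below the radial factor that must be divided out when passing from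
the Gaussian vector to the orbit. -/
theorem le_lintegral_gaussian_sum_sq_pow_four (p : ℕ) :
    ENNReal.ofReal ((p : ℝ) ^ 4) ≤
      ∫⁻ g, ENNReal.ofReal ((∑ i, g i ^ 2) ^ 4)
        ∂(Measure.pi fun _ : Fin p => gaussianReal 0 1) := by
  have hint : ∀ i : Fin p, Integrable (fun g : Fin p → ℝ => g i ^ 2)
        (Measure.pi fun _ : Fin p => gaussianReal 0 1) ∧
      ∫ g, g i ^ 2 ∂(Measure.pi fun _ : Fin p => gaussianReal 0 1) = 1 := by
    intro i
    have hmp := measurePreserving_eval (fun _ : Fin p => gaussianReal 0 1) i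
    constructor
    · exact hmp.integrable_comp_of_integrable
        (integrable_pow_of_memLp_four (memLp_gaussianReal_linear 1) (k := 2) (by norm_num))
    · have h := integral_map (μ := Measure.pi fun _ : Fin p => gaussianReal 0 1)
        (φ := Function.eval i) (f := fun x : ℝ => x ^ 2) (measurable_pi_apply i).aemeasurable
        (by fun_prop)
      rw [hmp.map_eq, integral_sq_gaussianReal] at h
      simpa using h.symm
  have hI : Integrable (fun g : Fin p → ℝ => ∑ i, g i ^ 2)
      (Measure.pi fun _ : Fin p => gaussianReal 0 1) :=
    integrable_finsetSum _ fun i _ => (hint i).1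
  have h1 : ∫⁻ g, ENNReal.ofReal (4 * (p : ℝ) ^ 3 * ∑ i, g i ^ 2)
      ∂(Measure.pi fun _ : Fin p => gaussianReal 0 1) =
      ENNReal.ofReal (p ^ 4) + ENNReal.ofReal (3 * p ^ 4) := by
    rw [← ofReal_integral_eq_lintegral_ofReal (hI.const_mul _)
      (ae_of_all _ fun g => by positivity), integral_const_mul,
      integral_finsetSum _ fun i _ => (hint i).1, ← ENNReal.ofReal_add (by positivity)
      (by positivity)]
    simp only [(hint _).2, Finset.sum_const, Finset.card_univ, Fintype.card_fin, nsmul_eq_mul]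
    congr 1; ring
  have h2 : ∫⁻ g, ENNReal.ofReal (4 * (p : ℝ) ^ 3 * ∑ i, g i ^ 2)
      ∂(Measure.pi fun _ : Fin p => gaussianReal 0 1) ≤
      ∫⁻ g, ENNReal.ofReal ((∑ i, g i ^ 2) ^ 4)
        ∂(Measure.pi fun _ : Fin p => gaussianReal 0 1) + ENNReal.ofReal (3 * p ^ 4) := by
    have : ENNReal.ofReal (3 * (p : ℝ) ^ 4) = ∫⁻ _, ENNReal.ofReal (3 * (p : ℝ) ^ 4)
      ∂(Measure.pi fun _ : Fin p => gaussianReal 0 1) := by simp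
    rw [this, ← lintegral_add_right _ measurable_const]
    refine lintegral_mono fun g => ?_
    simp only
    rw [← ENNReal.ofReal_add (by positivity) (by positivity)]
    refine ENNReal.ofReal_le_ofReal ?_
    have h0 : 0 ≤ ∑ i, g i ^ 2 := Finset.sum_nonneg fun i _ => sq_nonneg _
    set x := ∑ i, g i ^ 2
    have hp : (0 : ℝ) ≤ p := p.cast_nonneg
    -- The factorisation is x⁴ - 4p³x + 3p⁴ = (x - p)²(x² + 2px + 3p²).
    nlinarith [mul_nonneg (sq_nonneg (x - p))
      (show 0 ≤ x ^ 2 + 2 * p * x + 3 * (p : ℝ) ^ 2 by positivity)]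
  rw [h1] at h2
  exact (ENNReal.add_le_add_iff_right ENNReal.ofReal_ne_top).1 h2

theorem sum_sub_mean_sq_le {p : ℕ} (c : Fin p → ℝ) :
    ∑ j, (c j - (∑ i, c i) / p) ^ 2 ≤ ∑ j, c j ^ 2 := by
  rcases Nat.eq_zero_or_pos p with rfl | hp
  · simp
  have hp' : (p : ℝ) ≠ 0 := by positivity
  set m := (∑ i, c i) / p with hm
  have hs : ∑ i, c i = p * m := by rw [hm]; field_simp
  have : ∑ j, (c j - m) ^ 2 = ∑ j, c j ^ 2 - 2 * m * ∑ j, c j + p * m ^ 2 := by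
    simp only [sub_sq, Finset.sum_add_distrib, Finset.sum_sub_distrib, Finset.mul_sum]
    simp only [Finset.sum_const, Finset.card_univ, Fintype.card_fin, nsmul_eq_mul]
    congr 2
    exact Finset.sum_congr rfl fun j _ => by ring
  rw [this, hs]
  nlinarith [show (0 : ℝ) ≤ p * m ^ 2 by positivity]

/-- Diagonal quadratic forms of `O b` concentrate around their mean, in the fourth moment. -/
theorem exists_haar_quadratic_pow_four_le :
    ∃ K : ℝ, 0 ≤ K ∧ ∀ {Ω : Type*} [MeasurableSpace Ω] (μ : Measure Ω) [IsProbabilityMeasure μ]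
      {p : ℕ} (O : Ω → Matrix (Fin p) (Fin p) ℝ) (_ : IsHaarOrthogonal μ O) (_ : 0 < p)
      (B : ℝ) (c : Fin p → ℝ) (_ : ∀ j, |c j| ≤ B) (b : Fin p → ℝ),
      ∫⁻ ω, ENNReal.ofReal ((∑ j, c j * ((O ω *ᵥ b) j ^ 2 - (∑ i, b i ^ 2) / p)) ^ 4) ∂μ ≤
        ENNReal.ofReal (K * B ^ 4 * (∑ i, b i ^ 2) ^ 4 / p ^ 2) := by
  obtain ⟨K, hK, hg⟩ := exists_lintegral_pi_sum_pow_four_le (gaussianReal 0 1)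
    (fun x => x ^ 2 - ((1 : ℝ≥0) : ℝ)) (by fun_prop) (memLp_gaussianReal_sq_sub 1)
    (integral_sq_sub_gaussianReal 1)
  refine ⟨K, hK, ?_⟩
  intro Ω _ μ _ p O hO hp B c hc b
  have hp' : (0 : ℝ) < p := by exact_mod_cast hp
  -- Subtracting |w|²/p instead of a constant makes F homogeneous of degree 2, hence F⁴ of degree 8;
  -- on the orbit of b nothing changes, since |Ob| = |b|.
  set F : (Fin p → ℝ) → ℝ := fun w => ∑ j, c j * (w j ^ 2 - (∑ i, w i ^ 2) / p) with hF
  have hFm : Measurable F := by fun_prop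
  have hFhom : ∀ (s : ℝ) w, F (s • w) = s ^ 2 * F w := by
    intro s w
    have hs : ∑ i, s ^ 2 * w i ^ 2 = s ^ 2 * ∑ i, w i ^ 2 := (Finset.mul_sum _ _ _).symm
    simp only [hF, Pi.smul_apply, smul_eq_mul, mul_pow, hs]
    refine Eq.trans ?_ (Finset.mul_sum _ _ _).symm
    exact Finset.sum_congr rfl fun j _ => by ring
  have main := hO.lintegral_mulVec_mul_gaussian (G := fun w => ENNReal.ofReal (F w ^ 4))
    (by fun_prop) (fun s w => by
      rw [hFhom, ← ENNReal.ofReal_mul (by positivity)]; congr 1; ring) b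
  have hO' : ∀ ω, F (O ω *ᵥ b) = ∑ j, c j * ((O ω *ᵥ b) j ^ 2 - (∑ i, b i ^ 2) / p) := by
    intro ω
    simp only [hF, sum_sq_mulVec_of_mem_orthogonal (hO.mem_orthogonal ω)]
  simp only [hO'] at main
  have hgauss : ∫⁻ g, ENNReal.ofReal (F g ^ 4) ∂(Measure.pi fun _ : Fin p => gaussianReal 0 1) ≤
      ENNReal.ofReal (K * (p * B ^ 2) ^ 2) := by
    -- Subtracting |g|²/p amounts to centring the weights; centred weights sum to zero, so each g_j²
    -- may be replaced by g_j² - 1, giving a sum of independent centred terms.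
    have hFg : ∀ g, F g = ∑ j, (c j - (∑ i, c i) / p) * (g j ^ 2 - ((1 : ℝ≥0) : ℝ)) := by
      intro g
      simp only [hF, NNReal.coe_one, mul_sub, sub_mul, Finset.sum_sub_distrib, mul_one,
        Finset.sum_const, Finset.card_univ, Fintype.card_fin, nsmul_eq_mul, ← Finset.mul_sum,
        ← Finset.sum_mul]
      field_simp
      ring
    simp only [hFg]
    refine (hg p _).trans (ENNReal.ofReal_le_ofReal ?_)
    refine mul_le_mul_of_nonneg_left (pow_le_pow_left₀
      (Finset.sum_nonneg fun i _ => sq_nonneg _) ?_ 2) hK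
    refine (sum_sub_mean_sq_le c).trans ?_
    calc ∑ j, c j ^ 2 ≤ ∑ _j : Fin p, B ^ 2 :=
          Finset.sum_le_sum fun j _ => sq_le_sq' (abs_le.1 (hc j)).1 (abs_le.1 (hc j)).2
      _ = p * B ^ 2 := by simp
  set I := ∫⁻ ω, ENNReal.ofReal ((∑ j, c j * ((O ω *ᵥ b) j ^ 2 - (∑ i, b i ^ 2) / p)) ^ 4) ∂μ
  have h1 : ENNReal.ofReal ((p : ℝ) ^ 4) * I ≤
      ENNReal.ofReal ((p : ℝ) ^ 4) *
        ENNReal.ofReal (K * B ^ 4 * (∑ i, b i ^ 2) ^ 4 / p ^ 2) := by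
    calc ENNReal.ofReal ((p : ℝ) ^ 4) * I ≤ _ :=
          mul_le_mul_left (le_lintegral_gaussian_sum_sq_pow_four p) I
      _ = _ := main.symm
      _ ≤ ENNReal.ofReal ((∑ i, b i ^ 2) ^ 4) * ENNReal.ofReal (K * (p * B ^ 2) ^ 2) :=
          mul_le_mul_right hgauss _
      _ = _ := by
        rw [← ENNReal.ofReal_mul (by positivity), ← ENNReal.ofReal_mul (by positivity)]
        congr 1
        field_simp
  refine (ENNReal.mul_le_mul_iff_right ?_ ENNReal.ofReal_ne_top).1 h1
  simpa using hp.ne'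

/-! ### Almost sure convergence from fourth moments -/

/-- The joint law is a product, so Tonelli reduces the bound to a frozen first argument. This
carries moment bounds for deterministic weights over to random independent ones. -/
theorem lintegral_le_of_indepFun {Ω E F : Type*} [MeasurableSpace Ω] [MeasurableSpace E]
    [MeasurableSpace F] {μ : Measure Ω} [IsProbabilityMeasure μ] {A : Ω → E} {B : Ω → F}
    (hA : Measurable A) (hB : Measurable B) (h : IndepFun A B μ) {f : E × F → ℝ≥0∞}
    (hf : Measurable f) {M : ℝ≥0∞} (hM : ∀ᵐ ω ∂μ, ∫⁻ ω', f (A ω, B ω') ∂μ ≤ M) :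
    ∫⁻ ω, f (A ω, B ω) ∂μ ≤ M := by
  have h1 : ∫⁻ ω, f (A ω, B ω) ∂μ = ∫⁻ ω, ∫⁻ ω', f (A ω, B ω') ∂μ ∂μ := by
    rw [← lintegral_map (g := fun ω => (A ω, B ω)) hf (hA.prodMk hB),
      (indepFun_iff_map_prod_eq_prod_map_map hA.aemeasurable hB.aemeasurable).1 h]
    have : IsProbabilityMeasure (μ.map B) := Measure.isProbabilityMeasure_map hB.aemeasurable
    rw [lintegral_prod _ hf.aemeasurable, lintegral_map hf.lintegral_prod_right' hA]
    refine lintegral_congr fun ω => ?_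
    exact lintegral_map (f := fun y => f (A ω, y)) (hf.comp measurable_prodMk_left) hB
  rw [h1]
  calc _ ≤ ∫⁻ _, M ∂μ := lintegral_mono_ae hM
    _ = M := by simp

/-- The expected sum of the fourth powers is finite from some index N on, so the sum is finite
almost surely and its terms tend to 0. No relation between the variables for different n is needed.
-/
theorem tendsto_zero_of_lintegral_pow_four_le {Ω : Type*} [MeasurableSpace Ω] {μ : Measure Ω}
    {T : ℕ → Ω → ℝ} (hT : ∀ n, Measurable (T n)) {K : ℝ}
    (h : ∀ᶠ n : ℕ in atTop, ∫⁻ ω, ENNReal.ofReal (T n ω ^ 4) ∂μ ≤ ENNReal.ofReal (K / n ^ 2)) :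
    ∀ᵐ ω ∂μ, Tendsto (fun n => T n ω) atTop (𝓝 0) := by
  obtain ⟨N, hN⟩ := eventually_atTop.1 h
  have hs : Summable fun n : ℕ => |K| / ((n + N : ℕ) : ℝ) ^ 2 :=
    (summable_nat_add_iff (f := fun n : ℕ => |K| / (n : ℝ) ^ 2) N).2
      (by simpa [div_eq_mul_inv] using
        (Real.summable_nat_pow_inv.2 (by norm_num : 1 < 2)).mul_left |K|)
  have hfin : ∫⁻ ω, ∑' n, ENNReal.ofReal (T (n + N) ω ^ 4) ∂μ ≠ ∞ := by
    rw [lintegral_tsum fun n => ((hT _).pow_const 4).ennreal_ofReal.aemeasurable]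
    refine ne_top_of_le_ne_top hs.tsum_ofReal_ne_top (ENNReal.tsum_le_tsum fun n => ?_)
    refine (hN _ (Nat.le_add_left N n)).trans (ENNReal.ofReal_le_ofReal ?_)
    gcongr
    exact le_abs_self K
  have hae := ae_lt_top' (AEMeasurable.tsum fun n =>
    ((hT (n + N)).pow_const 4).ennreal_ofReal.aemeasurable) hfin
  filter_upwards [hae] with ω hω
  have h0 := ENNReal.tendsto_atTop_zero_of_tsum_ne_top hω.ne
  have h1 : Tendsto (fun n => T (n + N) ω ^ 4) atTop (𝓝 0) := by
    have := (ENNReal.tendsto_toReal ENNReal.zero_ne_top).comp h0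
    simpa [Function.comp_def, ENNReal.toReal_ofReal (by positivity : (0 : ℝ) ≤ T _ ω ^ 4)]
      using this
  have h2 : Tendsto (fun n => |T (n + N) ω|) atTop (𝓝 0) := by
    have h0 : Tendsto Real.sqrt (𝓝 0) (𝓝 0) := by simpa using Real.continuous_sqrt.tendsto 0
    refine (h0.comp (h0.comp h1)).congr fun n => ?_
    simp only [Function.comp_apply]
    rw [show T (n + N) ω ^ 4 = (T (n + N) ω ^ 2) ^ 2 by ring, Real.sqrt_sq (sq_nonneg _),
      Real.sqrt_sq_eq_abs]
  exact (tendsto_add_atTop_iff_nat N).1 ((tendsto_zero_iff_abs_tendsto_zero _).2 h2)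

theorem ofReal_div_pow_four_lintegral_le {Ω : Type*} [MeasurableSpace Ω] {μ : Measure Ω}
    {T : Ω → ℝ} {n : ℕ} (hn : 0 < n) {M K : ℝ} (hM : M ≤ K * n ^ 2)
    (h : ∫⁻ ω, ENNReal.ofReal (T ω ^ 4) ∂μ ≤ ENNReal.ofReal M) :
    ∫⁻ ω, ENNReal.ofReal ((T ω / n) ^ 4) ∂μ ≤ ENNReal.ofReal (K / n ^ 2) := by
  have hn' : (0 : ℝ) < n := by exact_mod_cast hn
  have : ∀ ω, ENNReal.ofReal ((T ω / n) ^ 4) =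
      ENNReal.ofReal (((n : ℝ) ^ 4)⁻¹) * ENNReal.ofReal (T ω ^ 4) := fun ω => by
    rw [← ENNReal.ofReal_mul (by positivity)]
    congr 1
    rw [div_pow]
    ring
  simp_rw [this]
  rw [lintegral_const_mul' _ _ ENNReal.ofReal_ne_top]
  refine (mul_le_mul_right h _).trans ?_
  rw [← ENNReal.ofReal_mul (by positivity)]
  refine ENNReal.ofReal_le_ofReal ?_
  rw [inv_mul_le_iff₀ (by positivity)]
  calc M ≤ K * n ^ 2 := hM
    _ = _ := by field_simp

/-- Linear forms of the noise are `o(n)` when their coefficients have norm `O(√n)`. -/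
theorem tendsto_noise_linear {Ω : Type*} [MeasurableSpace Ω] {μ : Measure Ω}
    [IsProbabilityMeasure μ] {v : ℝ≥0} {ε : ∀ n, Ω → Fin n → ℝ} (hε : ∀ n, Measurable (ε n))
    (hlaw : ∀ n, μ.map (ε n) = Measure.pi fun _ => gaussianReal 0 v)
    {u : ∀ n, Ω → Fin n → ℝ} (hu : ∀ n, Measurable (u n)) (hind : ∀ n, IndepFun (u n) (ε n) μ)
    {B : ℝ} (hB : ∀ᶠ n : ℕ in atTop, ∀ᵐ ω ∂μ, ∑ i, u n ω i ^ 2 ≤ B * n) :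
    ∀ᵐ ω ∂μ, Tendsto (fun n : ℕ => (∑ i, u n ω i * ε n ω i) / n) atTop (𝓝 0) := by
  obtain ⟨K, hK, hmom⟩ := exists_lintegral_pi_sum_pow_four_le (gaussianReal 0 v) (fun x => x)
    measurable_id (memLp_gaussianReal_linear v) integral_id_gaussianReal
  refine tendsto_zero_of_lintegral_pow_four_le (K := K * B ^ 2) (fun n => ?_) ?_
  · have h1 := fun i => measurable_pi_iff.1 (hu n) i
    have h2 := fun i => measurable_pi_iff.1 (hε n) i
    fun_prop
  filter_upwards [hB, eventually_gt_atTop 0] with n hBn hn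
  refine ofReal_div_pow_four_lintegral_le (M := K * (B * n) ^ 2) hn (by rw [mul_pow, mul_assoc]) ?_
  refine lintegral_le_of_indepFun (hu n) (hε n) (hind n)
    (f := fun q => ENNReal.ofReal ((∑ i, q.1 i * q.2 i) ^ 4)) (by fun_prop) ?_
  filter_upwards [hBn] with ω hω
  have := hmom n (u n ω)
  rw [← hlaw n, lintegral_map (by fun_prop) (hε n)] at this
  refine this.trans (ENNReal.ofReal_le_ofReal ?_)
  exact mul_le_mul_of_nonneg_left
    (pow_le_pow_left₀ (Finset.sum_nonneg fun i _ => sq_nonneg _) hω 2) hK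

/-- Diagonal quadratic forms of the rotated noise concentrate around their mean. -/
theorem tendsto_noise_quadratic {Ω : Type*} [MeasurableSpace Ω] {μ : Measure Ω}
    [IsProbabilityMeasure μ] {v : ℝ≥0} {ε : ∀ n, Ω → Fin n → ℝ} (hε : ∀ n, Measurable (ε n))
    (hlaw : ∀ n, μ.map (ε n) = Measure.pi fun _ => gaussianReal 0 v)
    {Q : ∀ n, Ω → Matrix (Fin n) (Fin n) ℝ} (hQ : ∀ n, Measurable (Q n))
    (hQo : ∀ n ω, Q n ω ∈ Matrix.orthogonalGroup (Fin n) ℝ)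
    {c : ∀ n, Ω → Fin n → ℝ} (hc : ∀ n, Measurable (c n)) {B : ℝ} (hB : ∀ n ω i, |c n ω i| ≤ B)
    (hind : ∀ n, IndepFun (fun ω => (Q n ω, c n ω)) (ε n) μ) :
    ∀ᵐ ω ∂μ, Tendsto
      (fun n : ℕ => (∑ i, c n ω i * ((Q n ω *ᵥ ε n ω) i ^ 2 - v)) / n) atTop (𝓝 0) := by
  obtain ⟨K, hK, hmom⟩ := exists_lintegral_pi_sum_pow_four_le (gaussianReal 0 v)
    (fun x => x ^ 2 - (v : ℝ)) (by fun_prop) (memLp_gaussianReal_sq_sub v)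
    (integral_sq_sub_gaussianReal v)
  refine tendsto_zero_of_lintegral_pow_four_le (K := K * (B ^ 2) ^ 2) (fun n => ?_) ?_
  · have h1 := fun i => measurable_pi_iff.1 (hc n) i
    have h2 := fun i => measurable_pi_iff.1 (measurable_mulVec (hQ n) (hε n)) i
    fun_prop
  filter_upwards [eventually_gt_atTop 0] with n hn
  refine ofReal_div_pow_four_lintegral_le (M := K * (n * B ^ 2) ^ 2) hn
    (by rw [mul_pow]; linarith) ?_
  refine lintegral_le_of_indepFun ((hQ n).prodMk (hc n)) (hε n) (hind n)
    (f := fun q => ENNReal.ofReal ((∑ i, q.1.2 i * ((q.1.1 *ᵥ q.2) i ^ 2 - v)) ^ 4)) ?_ ?_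
  · have h2 := fun i => measurable_pi_iff.1 (measurable_mulVec
      (A := fun q : (Matrix (Fin n) (Fin n) ℝ × (Fin n → ℝ)) × (Fin n → ℝ) => q.1.1)
      (measurable_fst.comp measurable_fst) measurable_snd) i
    fun_prop
  refine ae_of_all _ fun ω => ?_
  have h := hmom n (c n ω)
  -- With Q frozen, Qε has the law of ε, so the moment bound for i.i.d. coordinates applies to it.
  rw [← map_mulVec_pi_gaussianReal v (hQo n ω), lintegral_map (by fun_prop) (by fun_prop),
    ← hlaw n, lintegral_map (by fun_prop) (hε n)] at h
  refine h.trans (ENNReal.ofReal_le_ofReal ?_)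
  refine mul_le_mul_of_nonneg_left
    (pow_le_pow_left₀ (Finset.sum_nonneg fun i _ => sq_nonneg _) ?_ 2) hK
  calc ∑ i, c n ω i ^ 2 ≤ ∑ _i : Fin n, B ^ 2 :=
        Finset.sum_le_sum fun i _ => sq_le_sq' (abs_le.1 (hB n ω i)).1 (abs_le.1 (hB n ω i)).2
    _ = n * B ^ 2 := by simp

/-- Diagonal quadratic forms of the rotated signal concentrate around their mean. -/
theorem tendsto_signal_quadratic {Ω : Type*} [MeasurableSpace Ω] {μ : Measure Ω}
    [IsProbabilityMeasure μ] {p : ℕ → ℕ} {γ : ℝ} (hγ : 0 < γ)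
    (hp : Tendsto (fun n => (p n : ℝ) / n) atTop (𝓝 γ))
    {O : ∀ n, Ω → Matrix (Fin (p n)) (Fin (p n)) ℝ} (hO : ∀ n, IsHaarOrthogonal μ (O n))
    {r : ℝ} {b : ∀ n, Ω → Fin (p n) → ℝ} (hb : ∀ n, Measurable (b n))
    (hbr : ∀ᶠ n : ℕ in atTop, ∀ᵐ ω ∂μ, ∑ j, b n ω j ^ 2 = r ^ 2 * n)
    {c : ∀ n, Ω → Fin (p n) → ℝ} (hc : ∀ n, Measurable (c n)) {B : ℝ}
    (hB : ∀ n ω i, |c n ω i| ≤ B) (hind : ∀ n, IndepFun (c n) (O n) μ)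
    (hindb : ∀ n, IndepFun (b n) (fun ω => (c n ω, O n ω)) μ) :
    ∀ᵐ ω ∂μ, Tendsto (fun n : ℕ =>
      (∑ j, c n ω j * ((O n ω *ᵥ b n ω) j ^ 2 - r ^ 2 * n / p n)) / n) atTop (𝓝 0) := by
  obtain ⟨K, hK, hmom⟩ := exists_haar_quadratic_pow_four_le
  have hmeas : ∀ n, Measurable fun q : (Fin (p n) → ℝ) × (Fin (p n) → ℝ) ×
      Matrix (Fin (p n)) (Fin (p n)) ℝ => ENNReal.ofReal
        ((∑ j, q.2.1 j * ((q.2.2 *ᵥ q.1) j ^ 2 - r ^ 2 * n / p n)) ^ 4) := by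
    intro n
    have h2 := fun i => measurable_pi_iff.1 (measurable_mulVec
      (A := fun q : (Fin (p n) → ℝ) × (Fin (p n) → ℝ) × Matrix (Fin (p n)) (Fin (p n)) ℝ => q.2.2)
      (measurable_snd.comp measurable_snd) measurable_fst) i
    fun_prop
  refine tendsto_zero_of_lintegral_pow_four_le (K := K * B ^ 4 * (r ^ 2) ^ 4 / (γ / 2) ^ 2)
    (fun n => ?_) ?_
  · have h1 := fun i => measurable_pi_iff.1 (hc n) i
    have h2 := fun i => measurable_pi_iff.1 (measurable_mulVec (hO n).measurable (hb n)) i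
    fun_prop
  filter_upwards [hbr, eventually_gt_atTop 0, hp.eventually_const_le (half_lt_self hγ)]
    with n hbn hn hpn
  have hn' : (0 : ℝ) < n := by exact_mod_cast hn
  rw [le_div_iff₀ hn'] at hpn
  have hp0 : (0 : ℝ) < p n := lt_of_lt_of_le (by positivity) hpn
  -- Since p ≥ γn/2, the factor 1/p² of the Haar bound is at most a constant times 1/n².
  refine ofReal_div_pow_four_lintegral_le (M := K * B ^ 4 * (r ^ 2 * n) ^ 4 / p n ^ 2) hn ?_ ?_
  · rw [div_le_iff₀ (by positivity)]
    calc K * B ^ 4 * (r ^ 2 * n) ^ 4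
        = K * B ^ 4 * (r ^ 2) ^ 4 / (γ / 2) ^ 2 * n ^ 2 * (γ / 2 * n) ^ 2 := by
          field_simp
      _ ≤ _ := by gcongr
  -- Freeze the signal first, where its norm is known, and then the weights, so that only the Haar
  -- matrix stays random.
  refine lintegral_le_of_indepFun (hb n) ((hc n).prodMk (hO n).measurable) (hindb n)
    (hmeas n) ?_
  filter_upwards [hbn] with ω hω
  refine lintegral_le_of_indepFun (hc n) (hO n).measurable (hind n)
    (f := fun q => ENNReal.ofReal
      ((∑ j, q.1 j * ((q.2 *ᵥ b n ω) j ^ 2 - r ^ 2 * n / p n)) ^ 4))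
    ((hmeas n).comp measurable_prodMk_left) ?_
  refine ae_of_all _ fun ω' => ?_
  have := hmom μ (O n) (hO n) (by exact_mod_cast hp0) B (c n ω') (hB n ω') (b n ω)
  rwa [hω] at this

/-! ### The estimators for a design whose rows are orthogonal -/

/-- The characteristic polynomial fixes the eigenvalues as a multiset. Their indexing need not match
that of δ, which is why only symmetric sums are compared. -/
theorem sum_eigenvalues_eq_of_mul_transpose_eq_diagonal {ι κ : Type*} [Fintype ι] [DecidableEq ι]
    [Fintype κ] {X : Matrix ι κ ℝ} {δ : ι → ℝ} (hX : X * Xᵀ = Matrix.diagonal δ) (f : ℝ → ℝ) :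
    ∑ i, f ((Matrix.isHermitian_mul_conjTranspose_self X).eigenvalues i) = ∑ i, f (δ i) := by
  have h1 := (Matrix.isHermitian_mul_conjTranspose_self X).roots_charpoly_eq_eigenvalues
  have h0 : (X * Xᴴ).charpoly.roots = Finset.univ.val.map δ := by
    rw [Matrix.conjTranspose_eq_transpose_of_trivial, hX, Matrix.charpoly_diagonal]
    exact Polynomial.roots_multiset_prod_X_sub_C (Finset.univ.val.map δ) ▸ by
      rw [Multiset.map_map]; rfl
  rw [h0] at h1
  have h2 := congrArg (fun s => (s.map f).sum) h1
  simp only [Multiset.map_map] at h2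
  exact h2.symm

theorem companion_eq_of_mul_transpose_eq_diagonal {ι κ : Type*} [Fintype ι] [DecidableEq ι]
    [Fintype κ] {X : Matrix ι κ ℝ} {δ : ι → ℝ} (hX : X * Xᵀ = Matrix.diagonal δ) (z : ℝ) :
    companion X z = (∑ i, (δ i - z)⁻¹) / Fintype.card ι := by
  unfold companion stieltjes companionMeasure
  rw [integral_smul_measure, integral_finsetSum_measure]
  · simp only [integral_dirac]
    rw [sum_eigenvalues_eq_of_mul_transpose_eq_diagonal hX (fun x => (x - z)⁻¹)]
    simp [div_eq_inv_mul]
  · exact fun i _ => integrable_dirac (by simp)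

theorem deriv_companion_eq_of_mul_transpose_eq_diagonal {ι κ : Type*} [Fintype ι] [DecidableEq ι]
    [Fintype κ] {X : Matrix ι κ ℝ} {δ : ι → ℝ} (hX : X * Xᵀ = Matrix.diagonal δ)
    (hδ : ∀ i, 0 ≤ δ i) {l : ℝ} (hl : 0 < l) :
    deriv (companion X) (-l) = (∑ i, 1 / (δ i + l) ^ 2) / Fintype.card ι := by
  have h : companion X = fun z => (∑ i, (δ i - z)⁻¹) / Fintype.card ι :=
    funext (companion_eq_of_mul_transpose_eq_diagonal hX)
  rw [h]
  refine HasDerivAt.deriv (HasDerivAt.div_const (HasDerivAt.fun_sum fun i _ => ?_) _)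
  have hne : δ i - -l ≠ 0 := by have := hδ i; linarith
  have := ((hasDerivAt_id (-l)).const_sub (δ i)).fun_inv hne
  simpa using this

/-- Termwise, 1/(δ + l) - l/(δ + l)² = δ/(δ + l)². -/
theorem coeffA_eq_of_mul_transpose_eq_diagonal {ι κ : Type*} [Fintype ι] [DecidableEq ι]
    [Fintype κ] {X : Matrix ι κ ℝ} {δ : ι → ℝ} (hX : X * Xᵀ = Matrix.diagonal δ)
    (hδ : ∀ i, 0 ≤ δ i) {l : ℝ} (hl : 0 < l) (γ : ℝ) :
    coeffA γ X l = l ^ 2 / γ * ((∑ i, δ i / (δ i + l) ^ 2) / Fintype.card ι) := by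
  unfold coeffA
  rw [deriv_companion_eq_of_mul_transpose_eq_diagonal hX hδ hl,
    companion_eq_of_mul_transpose_eq_diagonal hX, mul_div_assoc', ← sub_div, Finset.mul_sum,
    ← Finset.sum_sub_distrib]
  congr 2
  refine Finset.sum_congr rfl fun i _ => ?_
  have hne : δ i + l ≠ 0 := by have := hδ i; linarith
  rw [sub_neg_eq_add]
  field_simp
  ring

theorem coeffB_eq_of_mul_transpose_eq_diagonal {ι κ : Type*} [Fintype ι] [DecidableEq ι]
    [Fintype κ] {X : Matrix ι κ ℝ} {δ : ι → ℝ} (hX : X * Xᵀ = Matrix.diagonal δ)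
    (hδ : ∀ i, 0 ≤ δ i) {l : ℝ} (hl : 0 < l) :
    coeffB X l = l ^ 2 * ((∑ i, 1 / (δ i + l) ^ 2) / Fintype.card ι) := by
  unfold coeffB
  rw [deriv_companion_eq_of_mul_transpose_eq_diagonal hX hδ hl]

/-- The ridge residual is w = l (XXᵀ + l)⁻¹ y, which is diagonal here. It is identified by checking
that l⁻¹ Xᵀw solves the normal equations, whose matrix is positive definite. -/
theorem trainError_eq_of_mul_transpose_eq_diagonal {ι κ : Type*} [Fintype ι] [DecidableEq ι]
    [Fintype κ] [DecidableEq κ] {X : Matrix ι κ ℝ} {δ : ι → ℝ} (hX : X * Xᵀ = Matrix.diagonal δ)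
    (hδ : ∀ i, 0 ≤ δ i) {l : ℝ} (hl : 0 < l) (y : ι → ℝ) :
    trainError X y l = l ^ 2 * ((∑ i, y i ^ 2 / (δ i + l) ^ 2) / Fintype.card ι) := by
  set w : ι → ℝ := fun i => l * y i / (δ i + l) with hw
  have hXw : X *ᵥ (Xᵀ *ᵥ w) = l • y - l • w := by
    rw [Matrix.mulVec_mulVec, hX]
    ext i
    have hne : δ i + l ≠ 0 := by have := hδ i; linarith
    simp only [Matrix.mulVec_diagonal, hw, Pi.sub_apply, Pi.smul_apply, smul_eq_mul]
    field_simp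
    ring
  have hpd : (Xᵀ * X + l • (1 : Matrix κ κ ℝ)).PosDef := by
    refine Matrix.PosDef.posSemidef_add ?_ (Matrix.PosDef.one.smul hl)
    simpa using Matrix.posSemidef_conjTranspose_mul_self X
  have hridge : ridge X y l = l⁻¹ • (Xᵀ *ᵥ w) := by
    have h1 : (Xᵀ * X + l • (1 : Matrix κ κ ℝ)) *ᵥ (l⁻¹ • (Xᵀ *ᵥ w)) = Xᵀ *ᵥ y := by
      rw [Matrix.add_mulVec, ← Matrix.mulVec_mulVec, Matrix.mulVec_smul, hXw, Matrix.smul_mulVec,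
        Matrix.one_mulVec, smul_smul, mul_inv_cancel₀ hl.ne', one_smul, ← smul_sub, smul_smul,
        inv_mul_cancel₀ hl.ne', one_smul, Matrix.mulVec_sub, sub_add_cancel]
    unfold ridge
    rw [← h1, Matrix.mulVec_mulVec, Matrix.nonsing_inv_mul _
      ((Matrix.isUnit_iff_isUnit_det _).1 hpd.isUnit), Matrix.one_mulVec]
  have hres : X *ᵥ ridge X y l = y - w := by
    rw [hridge, Matrix.mulVec_smul, hXw, ← smul_sub, smul_smul, inv_mul_cancel₀ hl.ne', one_smul]
  unfold trainError
  rw [hres, mul_div_assoc', Finset.mul_sum]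
  congr 1
  refine Finset.sum_congr rfl fun i _ => ?_
  simp only [Pi.sub_apply, sub_sub_cancel, hw]
  rw [div_pow]
  ring

/-! ### The reduced model -/

theorem rowsOf_mul_transpose {p : ℕ} {O : Matrix (Fin p) (Fin p) ℝ}
    (hO : O ∈ Matrix.orthogonalGroup (Fin p) ℝ) (S : Finset (Fin p)) :
    O * (rowsOf O S)ᵀ = (1 : Matrix (Fin p) (Fin p) ℝ).submatrix id Subtype.val := by
  have h : O * Oᵀ = 1 := (Matrix.mem_orthogonalGroup_iff (Fin p) ℝ).1 hO
  rw [← h]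
  rfl

theorem gram_eq_diagonal {n p : ℕ} {D : Matrix (Fin n) (Fin p) ℝ}
    (hD : ∀ (i : Fin n) (j : Fin p), i.val ≠ j.val → D i j = 0) :
    Dᵀ * D = Matrix.diagonal fun j => (Dᵀ * D) j j := by
  ext j l
  by_cases h : j = l
  · subst h; simp
  · rw [Matrix.diagonal_apply_ne _ h, Matrix.mul_apply]
    refine Finset.sum_eq_zero fun i _ => ?_
    by_cases hi : i.val = j.val
    · rw [hD i l (fun h' => h (Fin.ext (hi.symm.trans h'))), mul_zero]
    · rw [Matrix.transpose_apply, hD i j hi, zero_mul]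

theorem gram_self_nonneg {n p : ℕ} (D : Matrix (Fin n) (Fin p) ℝ) (j : Fin p) :
    0 ≤ (Dᵀ * D) j j := by
  rw [Matrix.mul_apply]
  exact Finset.sum_nonneg fun i _ => mul_self_nonneg _

theorem mulVec_alignedSignal {n p : ℕ} (J : Finset ℕ) (α : ℕ → ℝ) {O : Matrix (Fin p) (Fin p) ℝ}
    (hO : O ∈ Matrix.orthogonalGroup (Fin p) ℝ) (β' : Fin p → ℝ) (j : Fin p) :
    (O *ᵥ alignedSignal n J α O β') j =
      (O *ᵥ β') j + if j ∈ positions p J then Real.sqrt n * α j.val else 0 := by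
  have h : O * Oᵀ = 1 := (Matrix.mem_orthogonalGroup_iff (Fin p) ℝ).1 hO
  have hrow : ∀ i, (O *ᵥ O i) j = if j = i then 1 else 0 := fun i => by
    rw [← Matrix.one_apply, ← h]
    rfl
  unfold alignedSignal
  rw [Matrix.mulVec_add, Pi.add_apply, Matrix.mulVec_sum, Finset.sum_apply]
  simp only [Matrix.mulVec_smul, Pi.smul_apply, hrow, smul_eq_mul, mul_ite, mul_one, mul_zero]
  rw [Finset.sum_ite_eq]

/-- The columns of X_S are columns of QᵀD and have a diagonal Gram matrix, so the regression
decouples. Taking S = J yields the analysis of α̂; for residual S the alignment term drops out and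
y_new contains only β' and the noise. -/
theorem pcRegression_design_response {n p : ℕ} (J : Finset ℕ) (α : ℕ → ℝ)
    {Q : Matrix (Fin n) (Fin n) ℝ} {D : Matrix (Fin n) (Fin p) ℝ} {O : Matrix (Fin p) (Fin p) ℝ}
    (hQ : Q ∈ Matrix.orthogonalGroup (Fin n) ℝ)
    (hD : ∀ (i : Fin n) (j : Fin p), i.val ≠ j.val → D i j = 0)
    (hO : O ∈ Matrix.orthogonalGroup (Fin p) ℝ) (β' : Fin p → ℝ) (ε : Fin n → ℝ)
    {S : Finset (Fin p)} (hS : ∀ j ∈ S, (Dᵀ * D) j j ≠ 0) (j : S) :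
    pcRegression (design Q D O) O S (response J α Q D O β' ε) j =
      (O *ᵥ β') j + (if j.val ∈ positions p J then Real.sqrt n * α j.val else 0) +
        (Dᵀ *ᵥ (Q *ᵥ ε)) j / (Dᵀ * D) j j := by
  have hQQ : Q * Qᵀ = 1 := (Matrix.mem_orthogonalGroup_iff (Fin n) ℝ).1 hQ
  have hXS : design Q D O * (rowsOf O S)ᵀ = (Qᵀ * D).submatrix id Subtype.val := by
    unfold design
    rw [Matrix.mul_assoc, rowsOf_mul_transpose hO]
    ext i k
    simp [Matrix.mul_apply, Matrix.one_apply]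
  have hgram : ((Qᵀ * D).submatrix id (Subtype.val : S → Fin p))ᵀ *
      (Qᵀ * D).submatrix id (Subtype.val : S → Fin p) =
      Matrix.diagonal fun k : S => (Dᵀ * D) k.val k.val := by
    have h1 : (Qᵀ * D)ᵀ * (Qᵀ * D) = Dᵀ * D := by
      rw [Matrix.transpose_mul, Matrix.transpose_transpose, Matrix.mul_assoc, ← Matrix.mul_assoc Q,
        hQQ, Matrix.one_mul]
    have h2 : ((Qᵀ * D).submatrix id (Subtype.val : S → Fin p))ᵀ *
        (Qᵀ * D).submatrix id (Subtype.val : S → Fin p) =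
        ((Qᵀ * D)ᵀ * (Qᵀ * D)).submatrix Subtype.val Subtype.val := rfl
    rw [h2, h1, gram_eq_diagonal hD]
    ext k l
    by_cases h : k = l
    · subst h; simp
    · have h' : k.val ≠ l.val := fun h' => h (Subtype.ext h')
      simp [h, h']
  have hy : Dᵀ *ᵥ (Q *ᵥ response J α Q D O β' ε) =
      (Dᵀ * D) *ᵥ (O *ᵥ alignedSignal n J α O β') + Dᵀ *ᵥ (Q *ᵥ ε) := by
    unfold response design
    rw [Matrix.mulVec_add, Matrix.mulVec_add]
    congr 1
    simp only [Matrix.mulVec_mulVec, ← Matrix.mul_assoc]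
    rw [Matrix.mul_assoc Dᵀ Q, hQQ, Matrix.mul_one]
  have hXy : ((Qᵀ * D).submatrix id (Subtype.val : S → Fin p))ᵀ *ᵥ response J α Q D O β' ε =
      fun k : S => (Dᵀ *ᵥ (Q *ᵥ response J α Q D O β' ε)) k.val := by
    rw [Matrix.mulVec_mulVec]
    ext k
    have : (Dᵀ * Q) = (Qᵀ * D)ᵀ := by rw [Matrix.transpose_mul, Matrix.transpose_transpose]
    rw [this]
    rfl
  have hinv : (Matrix.diagonal fun k : S => (Dᵀ * D) k.val k.val)⁻¹ =
      Matrix.diagonal fun k : S => ((Dᵀ * D) k.val k.val)⁻¹ := by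
    refine Matrix.inv_eq_right_inv ?_
    rw [Matrix.diagonal_mul_diagonal, ← Matrix.diagonal_one]
    congr 1
    ext k
    exact mul_inv_cancel₀ (hS k.val k.2)
  simp only [pcRegression]
  rw [hXS, hgram, hXy, hinv, Matrix.mulVec_diagonal, hy, Pi.add_apply]
  have hdiag : ((Dᵀ * D) *ᵥ (O *ᵥ alignedSignal n J α O β')) j.val =
      (Dᵀ * D) j j * (O *ᵥ alignedSignal n J α O β') j := by
    conv_lhs => rw [gram_eq_diagonal hD]
    rw [Matrix.mulVec_diagonal]
  rw [hdiag, mulVec_alignedSignal J α hO]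
  have := hS j.val j.2
  field_simp

theorem reducedDesign_mul_transpose {n p : ℕ} (D : Matrix (Fin n) (Fin p) ℝ)
    {O : Matrix (Fin p) (Fin p) ℝ} (hO : O ∈ Matrix.orthogonalGroup (Fin p) ℝ)
    (S : Finset (Fin p)) :
    reducedDesign D O S * (reducedDesign D O S)ᵀ =
      Matrix.diagonal fun j : S => (Dᵀ * D) j.val j.val := by
  have h : rowsOf O S * (rowsOf O S)ᵀ = 1 := by
    have h1 : O * Oᵀ = 1 := (Matrix.mem_orthogonalGroup_iff (Fin p) ℝ).1 hO
    have h2 : rowsOf O S * (rowsOf O S)ᵀ = (O * Oᵀ).submatrix Subtype.val Subtype.val := rfl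
    rw [h2, h1, Matrix.submatrix_one _ Subtype.val_injective]
  unfold reducedDesign sqrtGram
  rw [Matrix.transpose_mul, Matrix.mul_assoc, ← Matrix.mul_assoc (rowsOf O S), h, Matrix.one_mul,
    Matrix.diagonal_transpose, Matrix.diagonal_mul_diagonal]
  congr 1
  ext j
  exact Real.mul_self_sqrt (gram_self_nonneg D _)

theorem mem_residualIndices {n p : ℕ} {D : Matrix (Fin n) (Fin p) ℝ} {J : Finset ℕ} {j : Fin p} :
    j ∈ residualIndices D J ↔ 0 < (Dᵀ * D) j j ∧ j.val ∉ J := by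
  simp [residualIndices, nonzeroIndices, positions]

theorem coeffA_reducedDesign {n p : ℕ} (D : Matrix (Fin n) (Fin p) ℝ)
    {O : Matrix (Fin p) (Fin p) ℝ} (hO : O ∈ Matrix.orthogonalGroup (Fin p) ℝ)
    (S : Finset (Fin p)) {l : ℝ} (hl : 0 < l) (γ : ℝ) :
    coeffA γ (reducedDesign D O S) l =
      l ^ 2 / γ * ((∑ j ∈ S, (Dᵀ * D) j j / ((Dᵀ * D) j j + l) ^ 2) / S.card) := by
  rw [coeffA_eq_of_mul_transpose_eq_diagonal (reducedDesign_mul_transpose D hO S)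
    (fun j => gram_self_nonneg D _) hl, Fintype.card_coe,
    Finset.sum_coe_sort S fun j => (Dᵀ * D) j j / ((Dᵀ * D) j j + l) ^ 2]

theorem coeffB_reducedDesign {n p : ℕ} (D : Matrix (Fin n) (Fin p) ℝ)
    {O : Matrix (Fin p) (Fin p) ℝ} (hO : O ∈ Matrix.orthogonalGroup (Fin p) ℝ)
    (S : Finset (Fin p)) {l : ℝ} (hl : 0 < l) :
    coeffB (reducedDesign D O S) l =
      l ^ 2 * ((∑ j ∈ S, 1 / ((Dᵀ * D) j j + l) ^ 2) / S.card) := by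
  rw [coeffB_eq_of_mul_transpose_eq_diagonal (reducedDesign_mul_transpose D hO S)
    (fun j => gram_self_nonneg D _) hl, Fintype.card_coe,
    Finset.sum_coe_sort S fun j => 1 / ((Dᵀ * D) j j + l) ^ 2]

/-- The training error of the reduced model, split into signal, cross and noise terms. The terms
with `d_j = 0` vanish, by the convention `x / 0 = 0`. -/
theorem trainError_reduced {n p : ℕ} (J : Finset ℕ) (α : ℕ → ℝ)
    {Q : Matrix (Fin n) (Fin n) ℝ} {D : Matrix (Fin n) (Fin p) ℝ} {O : Matrix (Fin p) (Fin p) ℝ}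
    (hQ : Q ∈ Matrix.orthogonalGroup (Fin n) ℝ)
    (hD : ∀ (i : Fin n) (j : Fin p), i.val ≠ j.val → D i j = 0)
    (hO : O ∈ Matrix.orthogonalGroup (Fin p) ℝ) (β' : Fin p → ℝ) (ε : Fin n → ℝ)
    {l : ℝ} (hl : 0 < l) :
    trainError (reducedDesign D O (residualIndices D J))
        (reducedResponse (design Q D O) D O (residualIndices D J) (response J α Q D O β' ε)) l =
      l ^ 2 * ((∑ j ∈ residualIndices D J,
        ((Dᵀ * D) j j / ((Dᵀ * D) j j + l) ^ 2 * (O *ᵥ β') j ^ 2 +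
          2 * ((O *ᵥ β') j / ((Dᵀ * D) j j + l) ^ 2 * (Dᵀ *ᵥ (Q *ᵥ ε)) j) +
          (Dᵀ *ᵥ (Q *ᵥ ε)) j ^ 2 / ((Dᵀ * D) j j * ((Dᵀ * D) j j + l) ^ 2))) /
        (residualIndices D J).card) := by
  rw [trainError_eq_of_mul_transpose_eq_diagonal (reducedDesign_mul_transpose D hO _)
    (fun j => gram_self_nonneg D _) hl, Fintype.card_coe,
    ← Finset.sum_coe_sort (residualIndices D J)]
  congr 2
  refine Finset.sum_congr rfl fun j _ => ?_
  obtain ⟨hj, hjJ⟩ := mem_residualIndices.1 j.2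
  unfold reducedResponse sqrtGram
  rw [Matrix.mulVec_diagonal, pcRegression_design_response J α hQ hD hO β' ε
    (fun k hk => (mem_residualIndices.1 hk).1.ne') j, mul_pow, Real.sq_sqrt hj.le,
    if_neg (by simpa [positions] using hjJ)]
  have h2 : (Dᵀ * D) j.val j.val + l ≠ 0 := by linarith
  field_simp
  ring

/-! ### Regression on the grid -/

/-- If `t = ρ a + τ b + o(1)`, the regression of `t / a` on `b / a` recovers `τ`. -/
theorem tendsto_grid_regression {L : ℕ} {t a b e : ℕ → Fin (L + 1) → ℝ} {ρ τ : ℕ → ℝ} {m M : ℝ}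
    (hm : 0 < m) (ha : ∀ᶠ n in atTop, ∀ i, m ≤ a n i ∧ a n i ≤ M)
    (hb : ∀ᶠ n in atTop, ∀ i, m ≤ b n i ∧ b n i ≤ M)
    (ht : ∀ᶠ n in atTop, ∀ i, t n i = ρ n * a n i + τ n * b n i + e n i)
    (he : ∀ i, Tendsto (fun n => e n i) atTop (𝓝 0)) {i₀ : Fin (L + 1)}
    (hdet : ∀ᶠ n in atTop, m ≤ |b n i₀ * a n 0 - b n 0 * a n i₀|) :
    Tendsto (fun n => (∑ i, (t n i / a n i - t n 0 / a n 0) * (b n i / a n i - b n 0 / a n 0)) /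
      (∑ i, (b n i / a n i - b n 0 / a n 0) ^ 2) - τ n) atTop (𝓝 0) := by
  have hlim : Tendsto (fun n => (∑ i, (|e n i| / m + |e n 0| / m) * (M / m + M / m)) /
      (m / M ^ 2) ^ 2) atTop (𝓝 0) := by
    have h := fun i => (he i).abs.div_const m
    have := (tendsto_finsetSum Finset.univ fun i _ =>
      ((h i).add (h 0)).mul_const (M / m + M / m)).div_const ((m / M ^ 2) ^ 2)
    simpa using this
  refine squeeze_zero_norm' ?_ hlim
  filter_upwards [ha, hb, ht, hdet] with n ha hb ht hdet
  have hM : 0 < M := hm.trans_le ((ha 0).1.trans (ha 0).2)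
  have hap : ∀ i, 0 < a n i := fun i => hm.trans_le (ha i).1
  have hbp : ∀ i, 0 < b n i := fun i => hm.trans_le (hb i).1
  set x : Fin (L + 1) → ℝ := fun i => b n i / a n i - b n 0 / a n 0 with hx
  set d : Fin (L + 1) → ℝ := fun i => e n i / a n i - e n 0 / a n 0 with hd
  -- A single grid point suffices: x at i₀ is the determinant divided by a product of two values of
  -- a, which is at most M².
  have hx0 : (m / M ^ 2) ^ 2 ≤ ∑ i, x i ^ 2 := by
    have h1 : m / M ^ 2 ≤ |x i₀| := by
      have : x i₀ = (b n i₀ * a n 0 - b n 0 * a n i₀) / (a n i₀ * a n 0) := by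
        have := (hap i₀).ne'; have := (hap 0).ne'
        simp only [hx]; field_simp
      rw [this, abs_div, abs_of_pos (mul_pos (hap i₀) (hap 0))]
      refine div_le_div₀ (abs_nonneg _) hdet (mul_pos (hap i₀) (hap 0)) ?_
      rw [sq]
      exact mul_le_mul (ha i₀).2 (ha 0).2 (hap 0).le hM.le
    calc (m / M ^ 2) ^ 2 ≤ |x i₀| ^ 2 := pow_le_pow_left₀ (by positivity) h1 2
      _ = x i₀ ^ 2 := sq_abs _
      _ ≤ _ := Finset.single_le_sum (f := fun i => x i ^ 2) (fun i _ => sq_nonneg _)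
        (Finset.mem_univ i₀)
  have hpos : 0 < ∑ i, x i ^ 2 := lt_of_lt_of_le (by positivity) hx0
  have hq : ∀ {c : Fin (L + 1) → ℝ} i, |c i / a n i| ≤ |c i| / m := fun {c} i => by
    rw [abs_div, abs_of_pos (hap i)]
    exact div_le_div_of_nonneg_left (abs_nonneg _) hm (ha i).1
  have hxb : ∀ i, |x i| ≤ M / m + M / m := fun i => by
    have hbM : ∀ i, |b n i / a n i| ≤ M / m := fun i =>
      (hq i).trans (by rw [abs_of_pos (hbp i)]; gcongr; exact (hb i).2)
    exact (abs_sub _ _).trans (add_le_add (hbM i) (hbM 0))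
  have hdb : ∀ i, |d i| ≤ |e n i| / m + |e n 0| / m := fun i =>
    (abs_sub _ _).trans (add_le_add (hq i) (hq 0))
  -- Dividing by a makes the ρ term constant in i, and differencing against index 0 removes it; no
  -- bound on ρ or τ is needed.
  have hmain : (∑ i, (t n i / a n i - t n 0 / a n 0) * x i) / (∑ i, x i ^ 2) - τ n =
      (∑ i, d i * x i) / ∑ i, x i ^ 2 := by
    rw [eq_div_iff hpos.ne', sub_mul, div_mul_cancel₀ _ hpos.ne', Finset.mul_sum,
      ← Finset.sum_sub_distrib]
    refine Finset.sum_congr rfl fun i _ => ?_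
    have h1 : t n i / a n i - t n 0 / a n 0 = τ n * x i + d i := by
      have := (hap i).ne'; have := (hap 0).ne'
      simp only [ht, hx, hd]; field_simp; ring
    rw [h1]; ring
  rw [hmain, Real.norm_eq_abs, abs_div, abs_of_pos hpos]
  refine div_le_div₀ ?_ ?_ (by positivity) hx0
  · exact Finset.sum_nonneg fun i _ => by positivity
  · refine (Finset.abs_sum_le_sum_abs _ _).trans (Finset.sum_le_sum fun i _ => ?_)
    rw [abs_mul]
    exact mul_le_mul (hdb i) (hxb i) (abs_nonneg _) (by positivity)

/-! ### The spread of the spectrum -/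

/-- Expand around the mean, where cross terms cancel. This links the variance in the hypothesis on
the spectrum to the pairwise form that the determinant produces. -/
theorem sum_sum_sub_sq {ι : Type*} (S : Finset ι) (q : ι → ℝ) :
    ∑ i ∈ S, ∑ j ∈ S, (q i - q j) ^ 2 =
      2 * S.card * ∑ i ∈ S, (q i - (∑ j ∈ S, q j) / S.card) ^ 2 := by
  rcases S.eq_empty_or_nonempty with rfl | hS
  · simp
  have hk : (S.card : ℝ) ≠ 0 := by exact_mod_cast hS.card_pos.ne'
  set x := (∑ j ∈ S, q j) / S.card with hx
  have hsum : ∑ j ∈ S, (q j - x) = 0 := by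
    rw [Finset.sum_sub_distrib, Finset.sum_const, nsmul_eq_mul, hx, mul_div_cancel₀ _ hk, sub_self]
  have h : ∀ i j, (q i - q j) ^ 2 = (q i - x) ^ 2 + (q j - x) ^ 2 - 2 * (q i - x) * (q j - x) :=
    fun i j => by ring
  simp only [h, Finset.sum_add_distrib, Finset.sum_sub_distrib, ← Finset.mul_sum, hsum,
    Finset.sum_const, nsmul_eq_mul, mul_zero, sub_zero]
  ring

theorem sum_sub_mean_sq_le_sum_sub_sq {ι : Type*} (S : Finset ι) (q : ι → ℝ) (x : ℝ) :
    ∑ i ∈ S, (q i - (∑ j ∈ S, q j) / S.card) ^ 2 ≤ ∑ i ∈ S, (q i - x) ^ 2 := by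
  rcases S.eq_empty_or_nonempty with rfl | hS
  · simp
  have hk : (S.card : ℝ) ≠ 0 := by exact_mod_cast hS.card_pos.ne'
  set m := (∑ j ∈ S, q j) / S.card with hm
  have hsum : ∑ j ∈ S, (q j - m) = 0 := by
    rw [Finset.sum_sub_distrib, Finset.sum_const, nsmul_eq_mul, hm, mul_div_cancel₀ _ hk, sub_self]
  have h : ∀ i, (q i - x) ^ 2 = (q i - m) ^ 2 + 2 * (m - x) * (q i - m) + (m - x) ^ 2 :=
    fun i => by ring
  simp only [h, Finset.sum_add_distrib, ← Finset.mul_sum, hsum, Finset.sum_const, nsmul_eq_mul]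
  have : 0 ≤ S.card * (m - x) ^ 2 := by positivity
  linarith

/-- Removing boundedly many values does not destroy the spread. -/
theorem spread_subset {ι : Type*} [DecidableEq ι] {N S : Finset ι} (hSN : S ⊆ N) {q : ι → ℝ}
    {M h s : ℝ} (hM : 0 < M) (hq : ∀ i ∈ N, 0 ≤ q i ∧ q i ≤ M) (hcard : ((N \ S).card : ℝ) ≤ h)
    (hs : s ≤ ∑ i ∈ N, (q i - (∑ j ∈ N, q j) / N.card) ^ 2) :
    2 * S.card * (s - h * M ^ 2) ≤ ∑ i ∈ S, ∑ j ∈ S, (q i - q j) ^ 2 ∧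
      s - h * M ^ 2 ≤ S.card * M ^ 2 := by
  set x := (∑ j ∈ S, q j) / S.card with hx
  have hx0 : 0 ≤ x := div_nonneg (Finset.sum_nonneg fun i hi => (hq i (hSN hi)).1) (by positivity)
  have hxM : x ≤ M := by
    refine div_le_of_le_mul₀ (by positivity) hM.le ?_
    calc ∑ j ∈ S, q j ≤ ∑ _j ∈ S, M := Finset.sum_le_sum fun i hi => (hq i (hSN hi)).2
      _ = M * S.card := by simp [mul_comm]
  have hone : ∀ i ∈ N, (q i - x) ^ 2 ≤ M ^ 2 := fun i hi => by
    have := hq i hi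
    exact sq_le_sq' (by linarith) (by linarith)
  -- Recentring the sum over N at the mean of S can only increase it; the deleted indices then
  -- account for at most h M².
  have h1 := sum_sub_mean_sq_le_sum_sub_sq N q x
  replace h1 := hs.trans h1
  rw [← Finset.sum_sdiff hSN] at h1
  have h2 : ∑ i ∈ N \ S, (q i - x) ^ 2 ≤ h * M ^ 2 := by
    calc _ ≤ ∑ _i ∈ N \ S, M ^ 2 :=
          Finset.sum_le_sum fun i hi => hone i (Finset.mem_sdiff.1 hi).1
      _ = (N \ S).card * M ^ 2 := by simp
      _ ≤ _ := by gcongr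
  have h3 : ∑ i ∈ S, (q i - x) ^ 2 ≤ S.card * M ^ 2 := by
    calc _ ≤ ∑ _i ∈ S, M ^ 2 := Finset.sum_le_sum fun i hi => hone i (hSN hi)
      _ = S.card * M ^ 2 := by simp
  have h4 : s - h * M ^ 2 ≤ ∑ i ∈ S, (q i - x) ^ 2 := by linarith
  refine ⟨?_, h4.trans h3⟩
  rw [sum_sum_sub_sq]
  gcongr

/-- Writing the determinant as a double sum and averaging it with its transpose turns each pair into
(l' - l)(q_i - q_j)² times a positive factor. That factor is bounded below using 0 ≤ q ≤ M. -/
theorem sum_sub_sq_mul_le {ι : Type*} (S : Finset ι) {q : ι → ℝ} {M : ℝ}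
    (hq : ∀ i ∈ S, 0 ≤ q i ∧ q i ≤ M) {l l' : ℝ} (hl : 0 < l) (hll : l ≤ l') :
    (l' - l) * (l * l') / ((M + l) * (M + l')) ^ 4 * ∑ i ∈ S, ∑ j ∈ S, (q i - q j) ^ 2 ≤
      (∑ i ∈ S, q i / (q i + l') ^ 2) * (∑ i ∈ S, 1 / (q i + l) ^ 2) -
        (∑ i ∈ S, q i / (q i + l) ^ 2) * ∑ i ∈ S, 1 / (q i + l') ^ 2 := by
  set R := (∑ i ∈ S, q i / (q i + l') ^ 2) * (∑ i ∈ S, 1 / (q i + l) ^ 2) -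
        (∑ i ∈ S, q i / (q i + l) ^ 2) * ∑ i ∈ S, 1 / (q i + l') ^ 2 with hR
  have hl' : 0 < l' := hl.trans_le hll
  have h1 : R = ∑ i ∈ S, ∑ j ∈ S, (q i / (q i + l') ^ 2 * (1 / (q j + l) ^ 2) -
      q i / (q i + l) ^ 2 * (1 / (q j + l') ^ 2)) := by
    simp only [hR, Finset.sum_mul_sum, Finset.sum_sub_distrib]
  have h2 : R = ∑ i ∈ S, ∑ j ∈ S, (q j / (q j + l') ^ 2 * (1 / (q i + l) ^ 2) -
      q j / (q j + l) ^ 2 * (1 / (q i + l') ^ 2)) := by rw [h1, Finset.sum_comm]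
  have h3 : 2 * R = ∑ i ∈ S, ∑ j ∈ S, (q i - q j) * (1 / ((q i + l') ^ 2 * (q j + l) ^ 2) -
      1 / ((q i + l) ^ 2 * (q j + l') ^ 2)) := by
    rw [two_mul]
    nth_rewrite 1 [h1]
    rw [h2, ← Finset.sum_add_distrib]
    refine Finset.sum_congr rfl fun i hi => ?_
    rw [← Finset.sum_add_distrib]
    refine Finset.sum_congr rfl fun j hj => ?_
    have := (hq i hi).1; have := (hq j hj).1
    have e1 : q i + l ≠ 0 := by positivity
    have e2 : q i + l' ≠ 0 := by positivity
    have e3 : q j + l ≠ 0 := by positivity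
    have e4 : q j + l' ≠ 0 := by positivity
    field_simp
    ring
  have h4 : 2 * ((l' - l) * (l * l') / ((M + l) * (M + l')) ^ 4 *
      ∑ i ∈ S, ∑ j ∈ S, (q i - q j) ^ 2) ≤ 2 * R := by
    rw [h3, Finset.mul_sum, Finset.mul_sum]
    refine Finset.sum_le_sum fun i hi => ?_
    rw [Finset.mul_sum, Finset.mul_sum]
    refine Finset.sum_le_sum fun j hj => ?_
    obtain ⟨i0, iM⟩ := hq i hi
    obtain ⟨j0, jM⟩ := hq j hj
    have hM : 0 ≤ M := i0.trans iM
    -- A difference of squares: for A = (q_i + l)(q_j + l') and B = (q_i + l')(q_j + l) one has A -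
    -- B = (l' - l)(q_i - q_j).
    have e : (q i - q j) * (1 / ((q i + l') ^ 2 * (q j + l) ^ 2) -
        1 / ((q i + l) ^ 2 * (q j + l') ^ 2)) = (l' - l) * (q i - q j) ^ 2 *
        (((q i + l) * (q j + l') + (q i + l') * (q j + l)) /
          (((q i + l) * (q i + l')) ^ 2 * ((q j + l) * (q j + l')) ^ 2)) := by
      have e1 : q i + l ≠ 0 := by positivity
      have e2 : q i + l' ≠ 0 := by positivity
      have e3 : q j + l ≠ 0 := by positivity
      have e4 : q j + l' ≠ 0 := by positivity
      field_simp
      ring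
    rw [e]
    have hle : 2 * (l * l') / ((M + l) * (M + l')) ^ 4 ≤
        ((q i + l) * (q j + l') + (q i + l') * (q j + l)) /
          (((q i + l) * (q i + l')) ^ 2 * ((q j + l) * (q j + l')) ^ 2) := by
      refine div_le_div₀ (by positivity) ?_ (by positivity) ?_
      · nlinarith [mul_nonneg i0 j0, mul_nonneg i0 hl.le, mul_nonneg i0 hl'.le,
          mul_nonneg j0 hl.le, mul_nonneg j0 hl'.le]
      · rw [show ((M + l) * (M + l')) ^ 4 =
          ((M + l) * (M + l')) ^ 2 * ((M + l) * (M + l')) ^ 2 by ring]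
        gcongr
    calc _ = (l' - l) * (q i - q j) ^ 2 * (2 * (l * l') / ((M + l) * (M + l')) ^ 4) := by ring
      _ ≤ _ := mul_le_mul_of_nonneg_left hle
        (mul_nonneg (sub_nonneg.2 hll) (sq_nonneg _))
  linarith

/-! ### Bounds for the regression coefficients -/

/-- The variance is at most the second moment, which is at most M times the mean. So spread alone
keeps the coefficient a away from zero, although individual singular values may be arbitrarily
small. -/
theorem le_sum_of_le_sum_sub_sq {ι : Type*} {S : Finset ι} (hS : S.Nonempty) {q : ι → ℝ} {M c : ℝ}
    (hM : 0 < M) (hq : ∀ i ∈ S, 0 ≤ q i ∧ q i ≤ M)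
    (hc : c * (S.card : ℝ) ^ 2 ≤ ∑ i ∈ S, ∑ j ∈ S, (q i - q j) ^ 2) :
    c / (2 * M) * S.card ≤ ∑ i ∈ S, q i := by
  have hk : (0 : ℝ) < S.card := by exact_mod_cast hS.card_pos
  have h1 := sum_sub_mean_sq_le_sum_sub_sq S q 0
  have h2 : ∑ i ∈ S, (q i - 0) ^ 2 ≤ M * ∑ i ∈ S, q i := by
    rw [Finset.mul_sum]
    refine Finset.sum_le_sum fun i hi => ?_
    have := hq i hi
    rw [sub_zero, sq]
    exact mul_le_mul_of_nonneg_right this.2 this.1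
  rw [sum_sum_sub_sq] at hc
  have h3 : c * (S.card : ℝ) ^ 2 ≤ 2 * S.card * (M * ∑ i ∈ S, q i) :=
    hc.trans (mul_le_mul_of_nonneg_left (h1.trans h2) (by positivity))
  have h4 : c * S.card ≤ 2 * (M * ∑ i ∈ S, q i) := by
    refine le_of_mul_le_mul_right ?_ hk
    linarith
  rw [div_mul_eq_mul_div, div_le_iff₀ (by positivity)]
  linarith

theorem abs_sum_mul_sub_ge {ι : Type*} (S : Finset ι) {q : ι → ℝ} {M : ℝ}
    (hq : ∀ i ∈ S, 0 ≤ q i ∧ q i ≤ M) {l l' : ℝ} (hl : 0 < l) (hl' : 0 < l') :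
    |l' - l| * (l * l') / ((M + l) * (M + l')) ^ 4 * ∑ i ∈ S, ∑ j ∈ S, (q i - q j) ^ 2 ≤
      |(∑ i ∈ S, 1 / (q i + l') ^ 2) * (∑ i ∈ S, q i / (q i + l) ^ 2) -
        (∑ i ∈ S, 1 / (q i + l) ^ 2) * ∑ i ∈ S, q i / (q i + l') ^ 2| := by
  rcases le_total l l' with h | h
  · rw [abs_of_nonneg (sub_nonneg.2 h), abs_sub_comm]
    refine (sum_sub_sq_mul_le S hq hl h).trans (le_trans (le_of_eq ?_) (le_abs_self _))
    ring
  · rw [abs_sub_comm, abs_of_nonneg (sub_nonneg.2 h)]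
    refine le_trans (le_of_eq ?_) ((sum_sub_sq_mul_le S hq hl' h).trans
      (le_trans (le_of_eq ?_) (le_abs_self _)))
    · ring
    · ring

/-- The order of quantifiers is the point: the constants depend on the grid, the spectral bound, the
spread and the range of g only, so one choice serves all large n. Below, `ma`, `mb` and `md` are the
lower bounds for a, for b and for the determinant. -/
theorem exists_coeff_bounds {M c g₁ g₂ : ℝ} (hM : 0 < M) (hc : 0 < c) (hg₁ : 0 < g₁)
    (hg₂ : 0 < g₂) {L : ℕ} {lam : Fin (L + 1) → ℝ} (hlam : ∀ i, 0 < lam i) {i₀ : Fin (L + 1)}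
    (hi₀ : lam i₀ ≠ lam 0) :
    ∃ m M' : ℝ, 0 < m ∧ ∀ {ι : Type} (S : Finset ι) (q : ι → ℝ) (g : ℝ), S.Nonempty →
      (∀ i ∈ S, 0 ≤ q i ∧ q i ≤ M) →
      c * (S.card : ℝ) ^ 2 ≤ ∑ i ∈ S, ∑ j ∈ S, (q i - q j) ^ 2 → g₁ ≤ g → g ≤ g₂ →
      ∀ a b : Fin (L + 1) → ℝ,
      (∀ i, a i = lam i ^ 2 / g * ((∑ j ∈ S, q j / (q j + lam i) ^ 2) / S.card)) →
      (∀ i, b i = lam i ^ 2 * ((∑ j ∈ S, 1 / (q j + lam i) ^ 2) / S.card)) →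
      (∀ i, m ≤ a i ∧ a i ≤ M') ∧ (∀ i, m ≤ b i ∧ b i ≤ M') ∧
        m ≤ |b i₀ * a 0 - b 0 * a i₀| := by
  obtain ⟨j₀, hj₀⟩ := Finite.exists_min lam
  obtain ⟨j₁, hj₁⟩ := Finite.exists_max lam
  set l₀ := lam j₀
  set l₁ := lam j₁
  have hl₀ : 0 < l₀ := hlam _
  have hl₁ : 0 < l₁ := hlam _
  set ma := l₀ ^ 2 / g₂ * (c / (2 * M) / (M + l₁) ^ 2)
  set mb := l₀ ^ 2 * (1 / (M + l₁) ^ 2)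
  set md := l₀ ^ 4 / g₂ * (|lam 0 - lam i₀| * (l₀ * l₀) / ((M + l₁) * (M + l₁)) ^ 4 * c)
  have hd : 0 < |lam 0 - lam i₀| := abs_pos.2 (sub_ne_zero.2 hi₀.symm)
  refine ⟨min ma (min mb md), max (l₁ ^ 2 / g₁ * (M / l₀ ^ 2)) (l₁ ^ 2 * (1 / l₀ ^ 2)),
    lt_min (by positivity) (lt_min (by positivity) (by positivity)), ?_⟩
  intro ι S q g hS hq hV hgl hgu a b ha hb
  have hk : (0 : ℝ) < S.card := by exact_mod_cast hS.card_pos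
  have hg : 0 < g := hg₁.trans_le hgl
  have hconst : ∀ x : ℝ, (∑ _j ∈ S, x) / S.card = x := fun x => by
    rw [Finset.sum_const, nsmul_eq_mul, mul_div_cancel_left₀ _ hk.ne']
  have hAu : ∀ i, (∑ j ∈ S, q j / (q j + lam i) ^ 2) / S.card ≤ M / l₀ ^ 2 := fun i => by
    rw [← hconst (M / l₀ ^ 2)]
    gcongr with j hj
    · exact (hq j hj).2
    · linarith [hj₀ i, (hq j hj).1]
  have hBu : ∀ i, (∑ j ∈ S, 1 / (q j + lam i) ^ 2) / S.card ≤ 1 / l₀ ^ 2 := fun i => by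
    rw [← hconst (1 / l₀ ^ 2)]
    gcongr with j hj
    linarith [hj₀ i, (hq j hj).1]
  have hpos : ∀ i, ∀ j ∈ S, 0 < q j + lam i := fun i j hj => by linarith [hlam i, (hq j hj).1]
  have hle : ∀ i, ∀ j ∈ S, q j + lam i ≤ M + l₁ := fun i j hj =>
    add_le_add (hq j hj).2 (hj₁ i)
  have hBl : ∀ i, 1 / (M + l₁) ^ 2 ≤ (∑ j ∈ S, 1 / (q j + lam i) ^ 2) / S.card := fun i => by
    rw [← hconst (1 / (M + l₁) ^ 2)]
    gcongr with j hj
    · exact pow_pos (hpos i j hj) 2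
    · exact (hpos i j hj).le
    · exact (hq j hj).2
    · exact hj₁ i
  have hAl : ∀ i, c / (2 * M) / (M + l₁) ^ 2 ≤
      (∑ j ∈ S, q j / (q j + lam i) ^ 2) / S.card := fun i => by
    rw [le_div_iff₀ hk]
    calc c / (2 * M) / (M + l₁) ^ 2 * S.card = c / (2 * M) * S.card / (M + l₁) ^ 2 := by ring
      _ ≤ (∑ j ∈ S, q j) / (M + l₁) ^ 2 := by
        gcongr
        exact le_sum_of_le_sum_sub_sq hS hM hq hV
      _ = ∑ j ∈ S, q j / (M + l₁) ^ 2 := Finset.sum_div _ _ _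
      _ ≤ _ := Finset.sum_le_sum fun j hj =>
        div_le_div_of_nonneg_left (hq j hj).1 (pow_pos (hpos i j hj) 2)
          (pow_le_pow_left₀ (hpos i j hj).le (hle i j hj) 2)
  refine ⟨fun i => ⟨(min_le_left _ _).trans ?_, le_trans ?_ (le_max_left _ _)⟩,
    fun i => ⟨(min_le_right _ _).trans ((min_le_left _ _).trans ?_),
      le_trans ?_ (le_max_right _ _)⟩, (min_le_right _ _).trans ((min_le_right _ _).trans ?_)⟩
  · rw [ha]
    have := hAl i
    have := hj₀ i
    simp only [ma]
    gcongr
  · rw [ha]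
    have := hlam i
    have h0 : 0 ≤ (∑ j ∈ S, q j / (q j + lam i) ^ 2) / S.card :=
      le_trans (by positivity) (hAl i)
    exact mul_le_mul (by gcongr; exact hj₁ i) (hAu i) h0 (by positivity)
  · rw [hb]
    exact mul_le_mul (pow_le_pow_left₀ hl₀.le (hj₀ i) 2) (hBl i) (by positivity) (by positivity)
  · rw [hb]
    have h0 : 0 ≤ (∑ j ∈ S, 1 / (q j + lam i) ^ 2) / (S.card : ℝ) := le_trans (by positivity) (hBl i)
    exact mul_le_mul (pow_le_pow_left₀ (hlam i).le (hj₁ i) 2) (hBu i) h0 (by positivity)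
  · have hab : b i₀ * a 0 - b 0 * a i₀ = lam i₀ ^ 2 * lam 0 ^ 2 / g *
        ((((∑ j ∈ S, 1 / (q j + lam i₀) ^ 2) * (∑ j ∈ S, q j / (q j + lam 0) ^ 2)) -
          (∑ j ∈ S, 1 / (q j + lam 0) ^ 2) * ∑ j ∈ S, q j / (q j + lam i₀) ^ 2) /
            (S.card : ℝ) ^ 2) := by
      rw [ha, ha, hb, hb]
      field_simp
    have h1 := abs_sum_mul_sub_ge S hq (hlam 0) (hlam i₀)
    have p0 := hlam 0
    have p1 := hlam i₀
    rw [hab, abs_mul, abs_of_pos (by positivity), abs_div, abs_of_pos (pow_pos hk 2)]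
    refine mul_le_mul ?_ ?_ (by positivity) (by positivity)
    · rw [show l₀ ^ 4 = l₀ ^ 2 * l₀ ^ 2 by ring]
      have := hj₀ 0
      have := hj₀ i₀
      gcongr
    · rw [le_div_iff₀ (by positivity), mul_assoc]
      refine le_trans ?_ h1
      rw [abs_sub_comm (lam i₀)]
      have := hj₀ 0
      have := hj₀ i₀
      have := hj₁ 0
      have := hj₁ i₀
      refine mul_le_mul ?_ hV (by positivity) (by positivity)
      gcongr

/-! ### Singular values -/

theorem gram_self_eq_sum_sq {n p : ℕ} (D : Matrix (Fin n) (Fin p) ℝ) (j : Fin p) :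
    (Dᵀ * D) j j = ∑ i, D i j ^ 2 := by
  simp [Matrix.mul_apply, sq]

theorem sq_le_gram_self {n p : ℕ} (D : Matrix (Fin n) (Fin p) ℝ) (i : Fin n) (j : Fin p) :
    D i j ^ 2 ≤ (Dᵀ * D) j j := by
  rw [gram_self_eq_sum_sq]
  exact Finset.single_le_sum (f := fun i => D i j ^ 2) (fun _ _ => sq_nonneg _) (Finset.mem_univ i)

theorem gram_self_le {n p : ℕ} {D : Matrix (Fin n) (Fin p) ℝ} {C : ℝ}
    (hD : ∀ (i : Fin n) (j : Fin p), i.val ≠ j.val → D i j = 0)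
    (h0 : ∀ i j, 0 ≤ D i j) (hC : ∀ i j, D i j ≤ C) (j : Fin p) : (Dᵀ * D) j j ≤ C ^ 2 := by
  rw [gram_self_eq_sum_sq]
  by_cases hj : j.val < n
  · rw [Finset.sum_eq_single ⟨j.val, hj⟩]
    · exact pow_le_pow_left₀ (h0 _ _) (hC _ _) 2
    · intro i _ hi
      rw [hD i j (fun h => hi (Fin.ext h)), zero_pow two_ne_zero]
    · simp
  · rw [Finset.sum_eq_zero]
    · positivity
    · intro i _
      rw [hD i j (fun h => hj (h ▸ i.2)), zero_pow two_ne_zero]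

theorem card_nonzeroIndices_le {n p : ℕ} {D : Matrix (Fin n) (Fin p) ℝ}
    (hD : ∀ (i : Fin n) (j : Fin p), i.val ≠ j.val → D i j = 0) :
    (nonzeroIndices D).card ≤ n := by
  calc (nonzeroIndices D).card ≤ (Finset.range n).card := by
        refine Finset.card_le_card_of_injOn Fin.val ?_ Fin.val_injective.injOn
        intro j hj
        have hj' : 0 < (Dᵀ * D) j j := by simpa [nonzeroIndices] using hj
        simp only [Finset.coe_range, Set.mem_Iio]
        by_contra hn
        rw [gram_self_eq_sum_sq, Finset.sum_eq_zero] at hj'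
        · exact lt_irrefl _ hj'
        · intro i _
          rw [hD i j (fun h => hn (h ▸ i.2)), zero_pow two_ne_zero]
    _ = n := Finset.card_range n

theorem residualIndices_subset {n p : ℕ} (D : Matrix (Fin n) (Fin p) ℝ) (J : Finset ℕ) :
    residualIndices D J ⊆ nonzeroIndices D := Finset.sdiff_subset

theorem card_nonzeroIndices_sdiff_le {n p : ℕ} (D : Matrix (Fin n) (Fin p) ℝ) (J : Finset ℕ) :
    (nonzeroIndices D \ residualIndices D J).card ≤ J.card := by
  refine Finset.card_le_card_of_injOn Fin.val ?_ Fin.val_injective.injOn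
  intro j hj
  simp only [residualIndices, positions, Finset.coe_sdiff, Set.mem_sdiff, Finset.mem_coe,
    Finset.coe_filter, Finset.mem_univ, true_and, Set.mem_ofPred_eq, not_and, not_not] at hj
  exact hj.2 hj.1

/-- The spread and the number of the nonzero singular values outside `J`. -/
theorem residual_spread {n p : ℕ} {D : Matrix (Fin n) (Fin p) ℝ} {C c : ℝ} {J : Finset ℕ}
    (hn : 0 < n) (hD : ∀ (i : Fin n) (j : Fin p), i.val ≠ j.val → D i j = 0)
    (h0 : ∀ i j, 0 ≤ D i j) (hC : ∀ i j, D i j ≤ C) (hc : 0 < c) (hs : c ≤ spectralSpread D)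
    (hJ : (J.card : ℝ) * (C ^ 2 + 1) ^ 2 ≤ c / 2 * n) :
    c * ((residualIndices D J).card : ℝ) ^ 2 ≤
        ∑ i ∈ residualIndices D J, ∑ j ∈ residualIndices D J,
          ((Dᵀ * D) i i - (Dᵀ * D) j j) ^ 2 ∧
      c / (2 * (C ^ 2 + 1) ^ 2) * n ≤ (residualIndices D J).card ∧
      ((residualIndices D J).card : ℝ) ≤ n := by
  have hn' : (0 : ℝ) < n := by exact_mod_cast hn
  have hkn : ((residualIndices D J).card : ℝ) ≤ n := by
    exact_mod_cast (Finset.card_le_card (residualIndices_subset D J)).trans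
      (card_nonzeroIndices_le hD)
  unfold spectralSpread meanNonzeroSq at hs
  rw [le_div_iff₀ hn'] at hs
  -- The bound `C ^ 2 + 1` stays positive when C = 0. Each index contributes at most its square to
  -- the spread, which forces k to grow linearly in n.
  obtain ⟨h1, h2⟩ := spread_subset (residualIndices_subset D J) (q := fun j => (Dᵀ * D) j j)
    (M := C ^ 2 + 1) (h := J.card) (by positivity)
    (fun j _ => ⟨gram_self_nonneg D j, (gram_self_le hD h0 hC j).trans (by linarith)⟩)
    (by exact_mod_cast card_nonzeroIndices_sdiff_le D J) hs
  have h3 : c / 2 * n ≤ c * n - J.card * (C ^ 2 + 1) ^ 2 := by linarith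
  refine ⟨?_, ?_, hkn⟩
  · refine le_trans ?_ h1
    calc c * ((residualIndices D J).card : ℝ) ^ 2
        = 2 * (residualIndices D J).card * (c / 2 * (residualIndices D J).card) := by ring
      _ ≤ 2 * (residualIndices D J).card * (c / 2 * n) := by gcongr
      _ ≤ _ := by gcongr
  · rw [div_mul_eq_mul_div, div_le_iff₀ (by positivity)]
    linarith

/-! ### The fluctuations of the training error -/

/-- The weights of the squared signal coordinates in the training error. -/
def signalWeight {n p : ℕ} (D : Matrix (Fin n) (Fin p) ℝ) (J : Finset ℕ) (l : ℝ) (j : Fin p) : ℝ :=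
  if j.val ∈ J then 0 else (Dᵀ * D) j j / ((Dᵀ * D) j j + l) ^ 2

/-- The weights of the squared noise coordinates in the training error. -/
def noiseWeight {n p : ℕ} (D : Matrix (Fin n) (Fin p) ℝ) (J : Finset ℕ) (l : ℝ) (i : Fin n) : ℝ :=
  ∑ j, if j.val ∈ J then 0 else D i j ^ 2 / ((Dᵀ * D) j j * ((Dᵀ * D) j j + l) ^ 2)

/-- The weighted signal `w_j / (d_j² + l)²` outside `J`. -/
def weightedSignal {n p : ℕ} (D : Matrix (Fin n) (Fin p) ℝ) (J : Finset ℕ) (l : ℝ) (w : Fin p → ℝ)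
    (j : Fin p) : ℝ :=
  if j.val ∈ J then 0 else w j / ((Dᵀ * D) j j + l) ^ 2

/-- The coefficients of the noise in the cross term of the training error. -/
def crossWeight {n p : ℕ} (Q : Matrix (Fin n) (Fin n) ℝ) (D : Matrix (Fin n) (Fin p) ℝ)
    (J : Finset ℕ) (l : ℝ) (w : Fin p → ℝ) : Fin n → ℝ :=
  Qᵀ *ᵥ (D *ᵥ weightedSignal D J l w)

/-- From q l ≤ (q + l)², with no bound on D. The concentration results ask for weights bounded for
every n and ω, whereas the singular values are bounded only almost surely and eventually. -/
theorem abs_signalWeight_le {n p : ℕ} (D : Matrix (Fin n) (Fin p) ℝ) (J : Finset ℕ) {l : ℝ}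
    (hl : 0 < l) (j : Fin p) : |signalWeight D J l j| ≤ 1 / l := by
  have hq := gram_self_nonneg D j
  unfold signalWeight
  split_ifs
  · rw [abs_zero]; positivity
  · rw [abs_of_nonneg (by positivity), div_le_div_iff₀ (by positivity) hl]
    nlinarith

/-- A row of D has at most one nonzero entry, and its square cancels against the factor d_j² in the
denominator. -/
theorem abs_noiseWeight_le {n p : ℕ} {D : Matrix (Fin n) (Fin p) ℝ}
    (hD : ∀ (i : Fin n) (j : Fin p), i.val ≠ j.val → D i j = 0) (J : Finset ℕ) {l : ℝ}
    (hl : 0 < l) (i : Fin n) : |noiseWeight D J l i| ≤ 1 / l ^ 2 := by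
  have hterm : ∀ j : Fin p, |if j.val ∈ J then 0 else
      D i j ^ 2 / ((Dᵀ * D) j j * ((Dᵀ * D) j j + l) ^ 2)| ≤ 1 / l ^ 2 := by
    intro j
    have hq := gram_self_nonneg D j
    split_ifs
    · rw [abs_zero]; positivity
    · rw [abs_of_nonneg (by positivity), ← div_div]
      have h1 : D i j ^ 2 / (Dᵀ * D) j j ≤ 1 := div_le_one_of_le₀ (sq_le_gram_self D i j) hq
      refine div_le_div₀ zero_le_one h1 (by positivity) ?_
      exact pow_le_pow_left₀ hl.le (by linarith) 2
  unfold noiseWeight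
  by_cases hi : i.val < p
  · rw [Finset.sum_eq_single ⟨i.val, hi⟩]
    · exact hterm _
    · intro j _ hj
      rw [hD i j (fun h => hj (Fin.ext h.symm))]
      simp
    · simp
  · rw [Finset.sum_eq_zero]
    · rw [abs_zero]; positivity
    · intro j _
      rw [hD i j (fun h => hi (h ▸ j.2))]
      simp

theorem sum_sq_transpose_mulVec_mulVec {n p : ℕ} {Q : Matrix (Fin n) (Fin n) ℝ}
    (hQ : Q ∈ Matrix.orthogonalGroup (Fin n) ℝ) {D : Matrix (Fin n) (Fin p) ℝ}
    (hD : ∀ (i : Fin n) (j : Fin p), i.val ≠ j.val → D i j = 0) (x : Fin p → ℝ) :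
    ∑ i, (Qᵀ *ᵥ (D *ᵥ x)) i ^ 2 = ∑ j, (Dᵀ * D) j j * x j ^ 2 := by
  have hQt : Qᵀ ∈ Matrix.orthogonalGroup (Fin n) ℝ := by
    rw [Matrix.mem_orthogonalGroup_iff]
    exact (Matrix.mem_orthogonalGroup_iff' (Fin n) ℝ).1 hQ
  rw [sum_sq_mulVec_of_mem_orthogonal hQt, sum_sq_eq_dotProduct, Matrix.dotProduct_mulVec,
    ← Matrix.mulVec_transpose, Matrix.mulVec_mulVec, gram_eq_diagonal hD]
  refine Finset.sum_congr rfl fun j _ => ?_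
  rw [Matrix.mulVec_diagonal, Matrix.diagonal_apply_eq]
  ring

theorem sum_transpose_mulVec_mulVec_mul {n p : ℕ} (Q : Matrix (Fin n) (Fin n) ℝ)
    (D : Matrix (Fin n) (Fin p) ℝ) (x : Fin p → ℝ) (ε : Fin n → ℝ) :
    ∑ i, (Qᵀ *ᵥ (D *ᵥ x)) i * ε i = ∑ j, x j * (Dᵀ *ᵥ (Q *ᵥ ε)) j := by
  change (Qᵀ *ᵥ (D *ᵥ x)) ⬝ᵥ ε = x ⬝ᵥ (Dᵀ *ᵥ (Q *ᵥ ε))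
  rw [Matrix.dotProduct_mulVec, Matrix.dotProduct_mulVec, Matrix.vecMul_transpose,
    Matrix.mulVec_transpose]

theorem sum_sq_crossWeight_le {n p : ℕ} {Q : Matrix (Fin n) (Fin n) ℝ}
    (hQ : Q ∈ Matrix.orthogonalGroup (Fin n) ℝ) {D : Matrix (Fin n) (Fin p) ℝ}
    (hD : ∀ (i : Fin n) (j : Fin p), i.val ≠ j.val → D i j = 0) (J : Finset ℕ) {l : ℝ}
    (hl : 0 < l) (w : Fin p → ℝ) :
    ∑ i, crossWeight Q D J l w i ^ 2 ≤ 1 / l ^ 3 * ∑ j, w j ^ 2 := by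
  unfold crossWeight
  rw [sum_sq_transpose_mulVec_mulVec hQ hD, Finset.mul_sum]
  refine Finset.sum_le_sum fun j _ => ?_
  have hq := gram_self_nonneg D j
  unfold weightedSignal
  set q := (Dᵀ * D) j j
  split_ifs
  · rw [zero_pow two_ne_zero, mul_zero]; positivity
  · have : q * (w j / (q + l) ^ 2) ^ 2 = q / (q + l) ^ 4 * w j ^ 2 := by
      field_simp
    rw [this]
    refine mul_le_mul_of_nonneg_right ?_ (sq_nonneg _)
    rw [div_le_div_iff₀ (by positivity) (by positivity), one_mul]
    have h3 : l ^ 3 ≤ (q + l) ^ 3 := pow_le_pow_left₀ hl.le (by linarith) 3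
    calc q * l ^ 3 ≤ (q + l) * (q + l) ^ 3 := by gcongr; linarith
      _ = (q + l) ^ 4 := by ring

theorem transpose_mulVec_sq {n p : ℕ} {D : Matrix (Fin n) (Fin p) ℝ}
    (hD : ∀ (i : Fin n) (j : Fin p), i.val ≠ j.val → D i j = 0) (η : Fin n → ℝ) (j : Fin p) :
    (Dᵀ *ᵥ η) j ^ 2 = ∑ i, D i j ^ 2 * η i ^ 2 := by
  simp only [Matrix.mulVec, dotProduct, Matrix.transpose_apply]
  by_cases hj : j.val < n
  · rw [Finset.sum_eq_single ⟨j.val, hj⟩, Finset.sum_eq_single ⟨j.val, hj⟩, mul_pow]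
    · intro i _ hi
      rw [hD i j (fun h => hi (Fin.ext h))]; ring
    · simp
    · intro i _ hi
      rw [hD i j (fun h => hi (Fin.ext h))]; ring
    · simp
  · have h0 : ∀ i, D i j = 0 := fun i => hD i j (fun h => hj (h ▸ i.2))
    simp [h0]

/-- Translates between the n coordinates of Qε, where the noise is i.i.d., and the p indices of
singular values, where the training error is written. -/
theorem sum_noiseWeight_mul {n p : ℕ} {D : Matrix (Fin n) (Fin p) ℝ}
    (hD : ∀ (i : Fin n) (j : Fin p), i.val ≠ j.val → D i j = 0) (J : Finset ℕ) (l : ℝ)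
    (η : Fin n → ℝ) (v : ℝ) :
    ∑ i, noiseWeight D J l i * (η i ^ 2 - v) =
      ∑ j : Fin p, if j.val ∈ J then 0 else
        ((Dᵀ *ᵥ η) j ^ 2 - v * (Dᵀ * D) j j) / ((Dᵀ * D) j j * ((Dᵀ * D) j j + l) ^ 2) := by
  unfold noiseWeight
  simp only [Finset.sum_mul]
  rw [Finset.sum_comm]
  refine Finset.sum_congr rfl fun j _ => ?_
  split_ifs
  · simp
  · rw [transpose_mulVec_sq hD]
    nth_rewrite 3 [gram_self_eq_sum_sq]
    rw [Finset.mul_sum, ← Finset.sum_sub_distrib, Finset.sum_div]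
    exact Finset.sum_congr rfl fun i _ => by ring

/-- The residual set is random. Extending by zero gives a sum over a fixed index set, with the
randomness moved into measurable weights. -/
theorem sum_residualIndices {n p : ℕ} (D : Matrix (Fin n) (Fin p) ℝ) (J : Finset ℕ)
    {f : Fin p → ℝ} (hf : ∀ j, (Dᵀ * D) j j = 0 → f j = 0) :
    ∑ j ∈ residualIndices D J, f j = ∑ j : Fin p, if j.val ∈ J then 0 else f j := by
  rw [← Finset.sum_subset (Finset.subset_univ (residualIndices D J))]
  · refine Finset.sum_congr rfl fun j hj => ?_
    rw [if_neg (mem_residualIndices.1 hj).2]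
  · intro j _ hj
    split_ifs with h
    · rfl
    · refine hf j (le_antisymm (not_lt.1 fun h' => hj (mem_residualIndices.2 ⟨h', h⟩)) ?_)
      exact gram_self_nonneg D j

theorem transpose_mulVec_eq_zero {n p : ℕ} {D : Matrix (Fin n) (Fin p) ℝ} {j : Fin p}
    (hj : (Dᵀ * D) j j = 0) (η : Fin n → ℝ) : (Dᵀ *ᵥ η) j = 0 := by
  simp only [Matrix.mulVec, dotProduct]
  refine Finset.sum_eq_zero fun i _ => ?_
  have h := sq_le_gram_self D i j
  rw [hj] at h
  rw [Matrix.transpose_apply, pow_eq_zero_iff two_ne_zero |>.1 (le_antisymm h (sq_nonneg _)),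
    zero_mul]

/-- The training error sum is its mean given `D` plus three fluctuation terms. -/
theorem trainError_sum_eq {n p : ℕ} (Q : Matrix (Fin n) (Fin n) ℝ) {D : Matrix (Fin n) (Fin p) ℝ}
    (hD : ∀ (i : Fin n) (j : Fin p), i.val ≠ j.val → D i j = 0) (J : Finset ℕ) {l : ℝ}
    (w : Fin p → ℝ) (ε : Fin n → ℝ) (s v : ℝ) :
    ∑ j ∈ residualIndices D J,
        ((Dᵀ * D) j j / ((Dᵀ * D) j j + l) ^ 2 * w j ^ 2 +
          2 * (w j / ((Dᵀ * D) j j + l) ^ 2 * (Dᵀ *ᵥ (Q *ᵥ ε)) j) +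
          (Dᵀ *ᵥ (Q *ᵥ ε)) j ^ 2 / ((Dᵀ * D) j j * ((Dᵀ * D) j j + l) ^ 2)) =
      s * (∑ j ∈ residualIndices D J, (Dᵀ * D) j j / ((Dᵀ * D) j j + l) ^ 2) +
      v * (∑ j ∈ residualIndices D J, 1 / ((Dᵀ * D) j j + l) ^ 2) +
      (∑ j, signalWeight D J l j * (w j ^ 2 - s) +
        2 * (∑ i, crossWeight Q D J l w i * ε i) +
        ∑ i, noiseWeight D J l i * ((Q *ᵥ ε) i ^ 2 - v)) := by
  have h1 : ∑ j, signalWeight D J l j * (w j ^ 2 - s) = ∑ j ∈ residualIndices D J,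
      (Dᵀ * D) j j / ((Dᵀ * D) j j + l) ^ 2 * (w j ^ 2 - s) := by
    rw [sum_residualIndices D J (fun j hj => by rw [hj, zero_div, zero_mul])]
    exact Finset.sum_congr rfl fun j _ => by unfold signalWeight; split_ifs <;> simp
  have h2 : ∑ i, crossWeight Q D J l w i * ε i = ∑ j ∈ residualIndices D J,
      w j / ((Dᵀ * D) j j + l) ^ 2 * (Dᵀ *ᵥ (Q *ᵥ ε)) j := by
    unfold crossWeight
    rw [sum_transpose_mulVec_mulVec_mul, sum_residualIndices D J
      (fun j hj => by rw [transpose_mulVec_eq_zero hj, mul_zero])]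
    exact Finset.sum_congr rfl fun j _ => by unfold weightedSignal; split_ifs <;> simp
  have h3 : ∑ i, noiseWeight D J l i * ((Q *ᵥ ε) i ^ 2 - v) = ∑ j ∈ residualIndices D J,
      ((Dᵀ *ᵥ (Q *ᵥ ε)) j ^ 2 - v * (Dᵀ * D) j j) /
        ((Dᵀ * D) j j * ((Dᵀ * D) j j + l) ^ 2) := by
    rw [sum_noiseWeight_mul hD, sum_residualIndices D J
      (fun j hj => by rw [hj, zero_mul, div_zero])]
  rw [h1, h2, h3, Finset.mul_sum, Finset.mul_sum, Finset.mul_sum, ← Finset.sum_add_distrib,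
    ← Finset.sum_add_distrib, ← Finset.sum_add_distrib, ← Finset.sum_add_distrib]
  refine Finset.sum_congr rfl fun j hj => ?_
  have hq := (mem_residualIndices.1 hj).1.ne'
  rw [sub_div, mul_comm v ((Dᵀ * D) j j), mul_div_mul_left _ _ hq]
  ring

/-- Consistency of the estimators on the event where the fluctuations vanish. -/
theorem tendsto_reduced_estimators {p : ℕ → ℕ} {Q : ∀ n, Matrix (Fin n) (Fin n) ℝ}
    {D : ∀ n, Matrix (Fin n) (Fin (p n)) ℝ} {O : ∀ n, Matrix (Fin (p n)) (Fin (p n)) ℝ}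
    (hQ : ∀ n, Q n ∈ Matrix.orthogonalGroup (Fin n) ℝ)
    (hO : ∀ n, O n ∈ Matrix.orthogonalGroup (Fin (p n)) ℝ) (h0 : ∀ n i j, 0 ≤ D n i j)
    (hD : ∀ n (i : Fin n) (j : Fin (p n)), i.val ≠ j.val → D n i j = 0) {C c : ℝ}
    (hC : ∀ᶠ n in atTop, ∀ i j, D n i j ≤ C) (hc : 0 < c)
    (hs : ∀ᶠ n in atTop, c ≤ spectralSpread (D n)) (J : Finset ℕ) (α : ℕ → ℝ)
    {β' : ∀ n, Fin (p n) → ℝ} {ε : ∀ n, Fin n → ℝ} {s : ℕ → ℝ} {v : ℝ}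
    {L : ℕ} {lam : Fin (L + 1) → ℝ} (hlam : ∀ i, 0 < lam i) (hgrid : ∃ i, lam i ≠ lam 0)
    (h1 : ∀ i, Tendsto (fun n : ℕ => (∑ j, signalWeight (D n) J (lam i) j *
      ((O n *ᵥ β' n) j ^ 2 - s n)) / n) atTop (𝓝 0))
    (h2 : ∀ i, Tendsto (fun n : ℕ => (∑ k, crossWeight (Q n) (D n) J (lam i) (O n *ᵥ β' n) k *
      ε n k) / n) atTop (𝓝 0))
    (h3 : ∀ i, Tendsto (fun n : ℕ => (∑ k, noiseWeight (D n) J (lam i) k *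
      ((Q n *ᵥ ε n) k ^ 2 - v)) / n) atTop (𝓝 0))
    {g : ℕ → ℝ} {g₁ g₂ : ℝ} (hg₁ : 0 < g₁) (hg₂ : 0 < g₂) (hg : ∀ᶠ n in atTop, g₁ ≤ g n ∧ g n ≤ g₂) :
    Tendsto (fun n => reducedRSqHat (g n) lam J (design (Q n) (D n) (O n)) (D n) (O n)
      (response J α (Q n) (D n) (O n) (β' n) (ε n)) - s n * g n) atTop (𝓝 0) ∧
    Tendsto (fun n => reducedSigmaSqHat (g n) lam J (design (Q n) (D n) (O n)) (D n) (O n)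
      (response J α (Q n) (D n) (O n) (β' n) (ε n))) atTop (𝓝 v) := by
  obtain ⟨i₀, hi₀⟩ := hgrid
  obtain ⟨m, M', hm, hbounds⟩ := exists_coeff_bounds (M := C ^ 2 + 1) (by positivity) hc hg₁ hg₂
    hlam hi₀
  set κ := c / (2 * (C ^ 2 + 1) ^ 2)
  have hκ0 : 0 < κ := by positivity
  set S := fun n => residualIndices (D n) J
  set a : ℕ → Fin (L + 1) → ℝ := fun n i => coeffA (g n) (reducedDesign (D n) (O n) (S n)) (lam i)
  set b : ℕ → Fin (L + 1) → ℝ := fun n i => coeffB (reducedDesign (D n) (O n) (S n)) (lam i)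
  set t : ℕ → Fin (L + 1) → ℝ := fun n i => trainError (reducedDesign (D n) (O n) (S n))
    (reducedResponse (design (Q n) (D n) (O n)) (D n) (O n) (S n)
      (response J α (Q n) (D n) (O n) (β' n) (ε n))) (lam i)
  set T : ℕ → Fin (L + 1) → ℝ := fun n i =>
    ∑ j, signalWeight (D n) J (lam i) j * ((O n *ᵥ β' n) j ^ 2 - s n) +
      2 * (∑ k, crossWeight (Q n) (D n) J (lam i) (O n *ᵥ β' n) k * ε n k) +
      ∑ k, noiseWeight (D n) J (lam i) k * ((Q n *ᵥ ε n) k ^ 2 - v)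
  set e : ℕ → Fin (L + 1) → ℝ := fun n i => lam i ^ 2 * (T n i / (S n).card)
  have hspread : ∀ᶠ n : ℕ in atTop, 0 < n ∧ (∀ j, (0 : ℝ) ≤ ((D n)ᵀ * D n) j j ∧
        ((D n)ᵀ * D n) j j ≤ C ^ 2 + 1) ∧
      c * ((S n).card : ℝ) ^ 2 ≤ ∑ i ∈ S n, ∑ j ∈ S n,
          (((D n)ᵀ * D n) i i - ((D n)ᵀ * D n) j j) ^ 2 ∧
      κ * n ≤ (S n).card := by
    have hJ : ∀ᶠ n : ℕ in atTop, (J.card : ℝ) * (C ^ 2 + 1) ^ 2 ≤ c / 2 * n :=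
      (tendsto_natCast_atTop_atTop.const_mul_atTop (half_pos hc)).eventually_ge_atTop _
    filter_upwards [hC, hs, hJ, eventually_gt_atTop 0] with n hCn hsn hJn hn
    have h := residual_spread hn (hD n) (h0 n) hCn hc hsn hJn
    exact ⟨hn, fun j => ⟨gram_self_nonneg _ j,
      (gram_self_le (hD n) (h0 n) hCn j).trans (by linarith)⟩, h.1, h.2.1⟩
  have hab : ∀ᶠ n in atTop, (∀ i, m ≤ a n i ∧ a n i ≤ M') ∧ (∀ i, m ≤ b n i ∧ b n i ≤ M') ∧
      m ≤ |b n i₀ * a n 0 - b n 0 * a n i₀| := by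
    filter_upwards [hspread, hg] with n ⟨hn, hq, hV, hk⟩ hgn
    have hn' : (0 : ℝ) < n := by exact_mod_cast hn
    have hkpos : (0 : ℝ) < (S n).card := lt_of_lt_of_le (by positivity) hk
    exact hbounds (S n) (fun j => ((D n)ᵀ * D n) j j) (g n)
      (Finset.card_pos.1 (by exact_mod_cast hkpos)) (fun j _ => hq j) hV hgn.1 hgn.2 _ _
      (fun i => coeffA_reducedDesign (D n) (hO n) (S n) (hlam i) (g n))
      (fun i => coeffB_reducedDesign (D n) (hO n) (S n) (hlam i))
  -- The factor g compensates the 1/g in a; this is how the aspect ratio enters the limit of r̂² but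
  -- not that of σ̂².
  have ht : ∀ᶠ n in atTop, ∀ i, t n i = (s n * g n) * a n i + v * b n i + e n i := by
    filter_upwards [hg] with n hgn i
    have hgpos : g n ≠ 0 := (hg₁.trans_le hgn.1).ne'
    simp only [t, a, b, e, T]
    rw [trainError_reduced J α (hQ n) (hD n) (hO n) (β' n) (ε n) (hlam i),
      coeffA_reducedDesign (D n) (hO n) _ (hlam i), coeffB_reducedDesign (D n) (hO n) _ (hlam i),
      trainError_sum_eq (Q n) (hD n) J (O n *ᵥ β' n) (ε n) (s n) v]
    simp only [S]
    field_simp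
  have hT0 : ∀ i, Tendsto (fun n : ℕ => T n i / n) atTop (𝓝 0) := by
    intro i
    have h := ((h1 i).add ((h2 i).const_mul 2)).add (h3 i)
    simp only [mul_zero, add_zero] at h
    refine h.congr fun n => ?_
    simp only [T]
    ring
  -- The fluctuations are o(n) while the training error is normalised by k, so the lower bound k ≥
  -- κn is essential.
  have he0 : ∀ i, Tendsto (fun n => e n i) atTop (𝓝 0) := by
    intro i
    have hlim : Tendsto (fun n : ℕ => lam i ^ 2 * (|T n i / n| / κ)) atTop (𝓝 0) := by
      simpa using ((hT0 i).abs.div_const κ).const_mul (lam i ^ 2)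
    refine squeeze_zero_norm' ?_ hlim
    filter_upwards [hspread] with n ⟨hn, _, _, hk⟩
    have hn' : (0 : ℝ) < n := by exact_mod_cast hn
    have hkpos : (0 : ℝ) < (S n).card := lt_of_lt_of_le (by positivity) hk
    simp only [e, Real.norm_eq_abs]
    rw [abs_mul, abs_of_nonneg (sq_nonneg (lam i)), abs_div, abs_div, abs_of_pos hkpos,
      abs_of_pos hn', div_div, mul_comm (n : ℝ) κ]
    gcongr
  constructor
  -- The estimator of r² is the same regression with a and b exchanged; the determinant only changes
  -- sign.
  · refine tendsto_grid_regression (t := t) (a := b) (b := a) (e := e) (ρ := fun _ => v)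
      (τ := fun n => s n * g n) (i₀ := i₀) hm (hab.mono fun n h => h.2.1) (hab.mono fun n h => h.1)
      ?_ he0 (hab.mono fun n h => ?_)
    · filter_upwards [ht] with n hn i
      rw [hn]; ring
    · refine h.2.2.trans (le_of_eq ?_)
      rw [← abs_neg]
      congr 1; ring
  · refine tendsto_sub_nhds_zero_iff.1 ?_
    exact tendsto_grid_regression (t := t) (a := a) (b := b) (e := e)
      (ρ := fun n => s n * g n) (τ := fun _ => v) (i₀ := i₀) hm (hab.mono fun n h => h.1)
      (hab.mono fun n h => h.2.1) ht he0 (hab.mono fun n h => h.2.2)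

/-! ### Measurability of the weights -/

theorem measurable_gram {n p : ℕ} (j : Fin p) :
    Measurable fun D : Matrix (Fin n) (Fin p) ℝ => (Dᵀ * D) j j :=
  measurable_matrix_entry
    (measurable_matrix_mul (measurable_matrix_transpose measurable_id) measurable_id) j j

theorem measurable_signalWeight {n p : ℕ} (J : Finset ℕ) (l : ℝ) :
    Measurable fun D : Matrix (Fin n) (Fin p) ℝ => signalWeight D J l := by
  refine measurable_pi_iff.2 fun j => ?_
  have h := measurable_gram (n := n) j
  unfold signalWeight
  split_ifs
  · exact measurable_const
  · exact h.div ((h.add_const l).pow_const 2)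

theorem measurable_noiseWeight {n p : ℕ} (J : Finset ℕ) (l : ℝ) :
    Measurable fun D : Matrix (Fin n) (Fin p) ℝ => noiseWeight D J l := by
  refine measurable_pi_iff.2 fun i => ?_
  unfold noiseWeight
  refine Finset.measurable_sum _ fun j _ => ?_
  have h := measurable_gram (n := n) j
  split_ifs
  · exact measurable_const
  · exact ((measurable_matrix_entry measurable_id i j).pow_const 2).div
      (h.mul ((h.add_const l).pow_const 2))

theorem measurable_crossWeight {Ω : Type*} [MeasurableSpace Ω] {n p : ℕ}
    {Q : Ω → Matrix (Fin n) (Fin n) ℝ} {D : Ω → Matrix (Fin n) (Fin p) ℝ} {w : Ω → Fin p → ℝ}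
    (hQ : Measurable Q) (hD : Measurable D) (hw : Measurable w) (J : Finset ℕ) (l : ℝ) :
    Measurable fun ω => crossWeight (Q ω) (D ω) J l (w ω) := by
  unfold crossWeight
  refine measurable_mulVec (measurable_matrix_transpose hQ) (measurable_mulVec hD ?_)
  refine measurable_pi_iff.2 fun j => ?_
  unfold weightedSignal
  split_ifs
  · exact measurable_const
  · exact (measurable_pi_iff.1 hw j).div
      ((((measurable_gram (n := n) j).comp hD).add_const l).pow_const 2)

/-! ### Principal components regression -/

theorem alphaHat_eq {n p : ℕ} (X : Matrix (Fin n) (Fin p) ℝ) (O : Matrix (Fin p) (Fin p) ℝ)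
    (J : Finset ℕ) (y : Fin n → ℝ) (j : positions p J) :
    alphaHat X O J y j.val.val = pcRegression X O (positions p J) y j / Real.sqrt n := by
  have h : ∃ k : Fin p, k ∈ positions p J ∧ k.val = j.val.val := ⟨j.val, j.2, rfl⟩
  unfold alphaHat
  rw [dif_pos h]
  congr 2
  exact Subtype.ext (Fin.ext h.choose_spec.2)

/-- The vector picking the normalized `i`-th principal component. -/
def componentSelector {n p : ℕ} (D : Matrix (Fin n) (Fin p) ℝ) (i : ℕ) (j : Fin p) : ℝ :=
  if j.val = i then Real.sqrt n / Real.sqrt ((Dᵀ * D) j j) else 0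

theorem measurable_componentSelector {n p : ℕ} (i : ℕ) :
    Measurable fun D : Matrix (Fin n) (Fin p) ℝ => componentSelector D i := by
  refine measurable_pi_iff.2 fun j => ?_
  unfold componentSelector
  split_ifs
  · exact measurable_const.div (measurable_gram (n := n) j).sqrt
  · exact measurable_const

/-- Normalising by d_i gives a bound valid for every D, as the noise estimate requires. The lower
bound on d_i, available only almost surely and eventually, is used afterwards. -/
theorem sum_gram_mul_componentSelector_sq_le {n p : ℕ} (D : Matrix (Fin n) (Fin p) ℝ) (i : ℕ) :
    ∑ j, (Dᵀ * D) j j * componentSelector D i j ^ 2 ≤ n := by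
  have hterm : ∀ j, (Dᵀ * D) j j * componentSelector D i j ^ 2 ≤ n := by
    intro j
    unfold componentSelector
    split_ifs
    · rw [div_pow, Real.sq_sqrt (Nat.cast_nonneg n), Real.sq_sqrt (gram_self_nonneg D j)]
      rcases eq_or_ne ((Dᵀ * D) j j) 0 with h | h
      · rw [h, zero_mul]; positivity
      · rw [mul_div_cancel₀ _ h]
    · simp
  by_cases hi : i < p
  · rw [Finset.sum_eq_single ⟨i, hi⟩]
    · exact hterm _
    · intro j _ hj
      unfold componentSelector
      rw [if_neg (fun h => hj (Fin.ext h))]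
      ring
    · simp
  · rw [Finset.sum_eq_zero]
    · positivity
    · intro j _
      unfold componentSelector
      rw [if_neg (fun h : j.val = i => hi (h ▸ j.2))]
      ring

/-- Consistency of the principal components regression when the fluctuations vanish. -/
theorem tendsto_alphaHat {p : ℕ → ℕ} (hp : Tendsto p atTop atTop)
    {Q : ∀ n, Matrix (Fin n) (Fin n) ℝ}
    {D : ∀ n, Matrix (Fin n) (Fin (p n)) ℝ} {O : ∀ n, Matrix (Fin (p n)) (Fin (p n)) ℝ}
    (hQ : ∀ n, Q n ∈ Matrix.orthogonalGroup (Fin n) ℝ)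
    (hO : ∀ n, O n ∈ Matrix.orthogonalGroup (Fin (p n)) ℝ)
    (hD : ∀ n (i : Fin n) (j : Fin (p n)), i.val ≠ j.val → D n i j = 0)
    {J : Finset ℕ} (α : ℕ → ℝ) {β' : ∀ n, Fin (p n) → ℝ} {ε : ∀ n, Fin n → ℝ}
    (hJ : ∀ i ∈ J, ∃ c > 0, ∀ᶠ n in atTop, ∀ j : Fin (p n), j.val = i → c ≤ ((D n)ᵀ * D n) j j)
    {i : ℕ} (hi : i ∈ J) {r : ℝ}
    (h1 : Tendsto (fun n : ℕ => (∑ j : Fin (p n), (if j.val = i then (1 : ℝ) else 0) *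
      ((O n *ᵥ β' n) j ^ 2 - r ^ 2 * n / p n)) / n) atTop (𝓝 0))
    (h2 : Tendsto (fun n : ℕ => (∑ k, ((Q n)ᵀ *ᵥ (D n *ᵥ componentSelector (D n) i)) k * ε n k) / n)
      atTop (𝓝 0)) :
    Tendsto (fun n => alphaHat (design (Q n) (D n) (O n)) (O n) J
      (response J α (Q n) (D n) (O n) (β' n) (ε n)) i) atTop (𝓝 (α i)) := by
  have hall : ∀ᶠ n in atTop, ∀ j ∈ positions (p n) J, ((D n)ᵀ * D n) j j ≠ 0 := by
    have h : ∀ᶠ n in atTop, ∀ k ∈ J, ∀ j : Fin (p n), j.val = k → 0 < ((D n)ᵀ * D n) j j := by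
      refine (eventually_all_finset J).2 fun k hk => ?_
      obtain ⟨c, hc, h⟩ := hJ k hk
      exact h.mono fun n hn j hj => hc.trans_le (hn j hj)
    filter_upwards [h] with n hn j hj
    exact (hn j.val (by simpa [positions] using hj) j rfl).ne'
  obtain ⟨c, hc, hci⟩ := hJ i hi
  have hpr : Tendsto (fun n => r ^ 2 / (p n : ℝ)) atTop (𝓝 0) :=
    (tendsto_natCast_atTop_atTop.comp hp).const_div_atTop (r ^ 2)
  have hlim : Tendsto (fun n : ℕ => Real.sqrt |(∑ j : Fin (p n), (if j.val = i then (1 : ℝ) else 0) *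
      ((O n *ᵥ β' n) j ^ 2 - r ^ 2 * n / p n)) / n + r ^ 2 / p n| +
      |(∑ k, ((Q n)ᵀ *ᵥ (D n *ᵥ componentSelector (D n) i)) k * ε n k) / n| / Real.sqrt c)
      atTop (𝓝 0) := by
    have h := ((Real.continuous_sqrt.tendsto _).comp (h1.add hpr).abs).add
      (h2.abs.div_const (Real.sqrt c))
    simpa using h
  refine tendsto_sub_nhds_zero_iff.1 (squeeze_zero_norm' ?_ hlim)
  filter_upwards [hall, hci, hp.eventually_gt_atTop i, eventually_gt_atTop 0] with n hn hcn hpn h0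
  have hn' : (0 : ℝ) < n := by exact_mod_cast h0
  have hsn : 0 < Real.sqrt n := Real.sqrt_pos.2 hn'
  set j : Fin (p n) := ⟨i, hpn⟩ with hj
  have hjJ : j ∈ positions (p n) J := by simpa [positions, hj] using hi
  have hqc : c ≤ ((D n)ᵀ * D n) j j := hcn j rfl
  have hq : 0 < ((D n)ᵀ * D n) j j := hc.trans_le hqc
  have hs : Real.sqrt c ≤ Real.sqrt (((D n)ᵀ * D n) j j) := Real.sqrt_le_sqrt hqc
  have hsc : 0 < Real.sqrt c := Real.sqrt_pos.2 hc
  have hsq : 0 < Real.sqrt (((D n)ᵀ * D n) j j) := Real.sqrt_pos.2 hq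
  set w := (O n *ᵥ β' n) j with hw
  set ζ := ((D n)ᵀ *ᵥ (Q n *ᵥ ε n)) j with hζ
  -- The indicator weight isolates w_i²/n minus its centring r²/p; adding this back exhibits w_i²/n
  -- as a null sequence.
  have e1 : (∑ j : Fin (p n), (if j.val = i then (1 : ℝ) else 0) *
      ((O n *ᵥ β' n) j ^ 2 - r ^ 2 * n / p n)) / n + r ^ 2 / p n = (w / Real.sqrt n) ^ 2 := by
    rw [Finset.sum_eq_single j]
    · rw [if_pos rfl, div_pow, Real.sq_sqrt hn'.le]
      field_simp
      ring
    · intro k _ hk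
      rw [if_neg (fun h => hk (Fin.ext h)), zero_mul]
    · simp
  have e2 : (∑ k, ((Q n)ᵀ *ᵥ (D n *ᵥ componentSelector (D n) i)) k * ε n k) / n =
      ζ / Real.sqrt (((D n)ᵀ * D n) j j) / Real.sqrt n := by
    rw [sum_transpose_mulVec_mulVec_mul, Finset.sum_eq_single j]
    · unfold componentSelector
      rw [if_pos rfl]
      nth_rewrite 2 [← Real.sq_sqrt hn'.le]
      field_simp
      rfl
    · intro k _ hk
      unfold componentSelector
      rw [if_neg (fun h => hk (Fin.ext h)), zero_mul]
    · simp
  have e3 : alphaHat (design (Q n) (D n) (O n)) (O n) J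
      (response J α (Q n) (D n) (O n) (β' n) (ε n)) i - α i =
      w / Real.sqrt n + ζ / ((D n)ᵀ * D n) j j / Real.sqrt n := by
    have h := alphaHat_eq (design (Q n) (D n) (O n)) (O n) J
      (response J α (Q n) (D n) (O n) (β' n) (ε n)) ⟨j, hjJ⟩
    rw [pcRegression_design_response J α (hQ n) (hD n) (hO n) (β' n) (ε n) hn, if_pos hjJ] at h
    simp only [hj] at h
    rw [h]
    simp only [hw, hζ, hj]
    field_simp
    ring
  rw [e1, e2, e3, Real.norm_eq_abs, abs_of_nonneg (sq_nonneg (w / Real.sqrt n)),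
    Real.sqrt_sq_eq_abs]
  refine (abs_add_le _ _).trans (add_le_add le_rfl ?_)
  -- The remaining division by d_i costs at most 1/√c.
  have e4 : ζ / ((D n)ᵀ * D n) j j / Real.sqrt n =
      ζ / Real.sqrt (((D n)ᵀ * D n) j j) / Real.sqrt n / Real.sqrt (((D n)ᵀ * D n) j j) := by
    nth_rewrite 1 [← Real.mul_self_sqrt hq.le]
    field_simp
  rw [e4, abs_div _ (Real.sqrt (((D n)ᵀ * D n) j j)), abs_of_pos hsq]
  exact div_le_div_of_nonneg_left (abs_nonneg _) hsc hs

/-! ### Independence in the random design -/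

theorem IsRightRotInvariant.indepFun_orthogonal {Ω E : Type*} [MeasurableSpace Ω]
    [MeasurableSpace E] {μ : Measure Ω} {n p : ℕ} {Q : Ω → Matrix (Fin n) (Fin n) ℝ}
    {D : Ω → Matrix (Fin n) (Fin p) ℝ} {O : Ω → Matrix (Fin p) (Fin p) ℝ}
    (h : IsRightRotInvariant μ Q D O) {f : Matrix (Fin n) (Fin p) ℝ → E} (hf : Measurable f) :
    IndepFun (fun ω => f (D ω)) O μ :=
  (h.indep.comp measurable_id (hf.comp measurable_snd)).symm

end RotiGCV

end

/-! ### Almost sure assembly of the strong consistency statements -/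

open RotiGCV
theorem mainTheorem8 {Ω : Type*} [MeasurableSpace Ω] (μ : Measure Ω) [IsProbabilityMeasure μ]
    -- dimensions: `X n` is `n × p n`, with `p n / n → γ`
    (p : ℕ → ℕ) (γ : ℝ) (hγ : 0 < γ)
    (hp : Tendsto (fun n => (p n : ℝ) / n) atTop (𝓝 γ))
    -- the right-rotationally invariant designs
    (Q : ∀ n, Ω → Matrix (Fin n) (Fin n) ℝ)
    (D : ∀ n, Ω → Matrix (Fin n) (Fin (p n)) ℝ)
    (O : ∀ n, Ω → Matrix (Fin (p n)) (Fin (p n)) ℝ)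
    (hX : ∀ n, IsRightRotInvariant μ (Q n) (D n) (O n))
    -- the singular values are almost surely asymptotically bounded by a constant
    (C : ℝ) (hC : ∀ᵐ ω ∂μ, ∀ᶠ n in atTop, ∀ i j, D n ω i j ≤ C)
    -- the aligned indices and coefficients, the same for all `n`
    (J : Finset ℕ) (α : ℕ → ℝ)
    -- the unaligned part of the signal
    (r : ℝ) (β' : ∀ n, Ω → Fin (p n) → ℝ) (hβ : ∀ n, Measurable (β' n))
    (hβ_indep : ∀ n, IndepFun (β' n) (fun ω => (Q n ω, D n ω, O n ω)) μ)
    (hβ_norm : ∀ᶠ n : ℕ in atTop, ∀ᵐ ω ∂μ, ∑ j, (β' n ω j) ^ 2 = r ^ 2 * n)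
    -- Gaussian noise with variance `v = σ²`, independent of everything else
    (v : ℝ≥0) (ε : ∀ n, Ω → Fin n → ℝ) (hε : ∀ n, Measurable (ε n))
    (hε_law : ∀ n, μ.map (ε n) = Measure.pi fun _ => gaussianReal 0 v)
    (hε_indep : ∀ n, IndepFun (ε n) (fun ω => (Q n ω, D n ω, O n ω, β' n ω)) μ)
    -- the aligned singular values are nonzero, also in the limit
    (hJ : ∀ i ∈ J, ∀ᵐ ω ∂μ, ∃ c > 0, ∀ᶠ n in atTop,
      ∀ j : Fin (p n), j.val = i → c ≤ ((D n ω)ᵀ * D n ω) j j)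
    -- the nonzero singular values do not all become equal in the limit
    (hspread : ∀ᵐ ω ∂μ, ∃ c > 0, ∀ᶠ n in atTop, c ≤ spectralSpread (D n ω))
    -- the grid of regularization strengths, with at least two different values
    (L : ℕ) (lam : Fin (L + 1) → ℝ) (hlam : ∀ i, 0 < lam i) (hgrid : ∃ i, lam i ≠ lam 0)
    -- the data
    (X : ∀ n, Ω → Matrix (Fin n) (Fin (p n)) ℝ)
    (hXdef : ∀ n ω, X n ω = design (Q n ω) (D n ω) (O n ω))
    (y : ∀ n, Ω → Fin n → ℝ)
    (hydef : ∀ n ω, y n ω = response J α (Q n ω) (D n ω) (O n ω) (β' n ω) (ε n ω)) :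
    -- the estimate of `α` is strongly consistent
    (∀ i ∈ J, ∀ᵐ ω ∂μ,
      Tendsto (fun n => alphaHat (X n ω) (O n ω) J (y n ω) i) atTop (𝓝 (α i))) ∧
    -- the estimates of `r²` and `σ²`, with the aspect ratio `p / n` of the data
    (∀ᵐ ω ∂μ, Tendsto
      (fun n => reducedRSqHat ((p n : ℝ) / n) lam J (X n ω) (D n ω) (O n ω) (y n ω))
      atTop (𝓝 (r ^ 2))) ∧
    (∀ᵐ ω ∂μ, Tendsto
      (fun n => reducedSigmaSqHat ((p n : ℝ) / n) lam J (X n ω) (D n ω) (O n ω) (y n ω))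
      atTop (𝓝 (v : ℝ))) ∧
    -- the same with the aspect ratio `p / k` of the reduced model, which has `k` observations
    -- and therefore the signal strength `‖β'‖² / k`
    (∀ᵐ ω ∂μ, Tendsto
      (fun n =>
        reducedRSqHat ((p n : ℝ) / (residualIndices (D n ω) J).card) lam J
            (X n ω) (D n ω) (O n ω) (y n ω)
          - (∑ j, (β' n ω j) ^ 2) / (residualIndices (D n ω) J).card)
      atTop (𝓝 0)) ∧
    (∀ᵐ ω ∂μ, Tendsto
      (fun n => reducedSigmaSqHat ((p n : ℝ) / (residualIndices (D n ω) J).card) lam J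
        (X n ω) (D n ω) (O n ω) (y n ω))
      atTop (𝓝 (v : ℝ))) := by
  have hQ : ∀ n ω, Q n ω ∈ Matrix.orthogonalGroup (Fin n) ℝ := fun n => (hX n).left_orthogonal
  have hO : ∀ n ω, O n ω ∈ Matrix.orthogonalGroup (Fin (p n)) ℝ :=
    fun n => (hX n).haar.mem_orthogonal
  have hD : ∀ n ω (i : Fin n) (j : Fin (p n)), i.val ≠ j.val → D n ω i j = 0 :=
    fun n => (hX n).diag_off
  have hQm : ∀ n, Measurable (Q n) := fun n => (hX n).measurable_left
  have hDm : ∀ n, Measurable (D n) := fun n => (hX n).measurable_diag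
  have hOm : ∀ n, Measurable (O n) := fun n => (hX n).haar.measurable
  have hptop : Tendsto p atTop atTop := by
    refine (tendsto_natCast_atTop_iff (R := ℝ)).1 ?_
    refine (hp.pos_mul_atTop hγ tendsto_natCast_atTop_atTop).congr' ?_
    filter_upwards [eventually_gt_atTop 0] with n hn
    exact div_mul_cancel₀ _ (by exact_mod_cast hn.ne')
  -- Weights that are functions of D alone are independent of the Haar matrix. The general f serves
  -- both the training error and the indicator weight for α̂.
  have hsignal : ∀ f : ∀ n, Matrix (Fin n) (Fin (p n)) ℝ → Fin (p n) → ℝ,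
      (∀ n, Measurable (f n)) → ∀ B : ℝ, (∀ n A j, |f n A j| ≤ B) →
      ∀ᵐ ω ∂μ, Tendsto (fun n : ℕ => (∑ j, f n (D n ω) j *
        ((O n ω *ᵥ β' n ω) j ^ 2 - r ^ 2 * n / p n)) / n) atTop (𝓝 0) := by
    intro f hf B hB
    refine tendsto_signal_quadratic hγ hp (fun n => (hX n).haar) hβ hβ_norm
      (c := fun n ω => f n (D n ω)) (fun n => (hf n).comp (hDm n)) (B := B)
      (fun n ω j => hB n _ j) (fun n => (hX n).indepFun_orthogonal (hf n)) (fun n => ?_)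
    exact (hβ_indep n).comp measurable_id
      (((hf n).comp (measurable_fst.comp measurable_snd)).prodMk
        (measurable_snd.comp measurable_snd))
  have hT1 : ∀ᵐ ω ∂μ, ∀ i, Tendsto (fun n : ℕ => (∑ j, signalWeight (D n ω) J (lam i) j *
      ((O n ω *ᵥ β' n ω) j ^ 2 - r ^ 2 * n / p n)) / n) atTop (𝓝 0) :=
    ae_all_iff.2 fun i => hsignal (fun n A => signalWeight A J (lam i))
      (fun n => measurable_signalWeight J (lam i)) (1 / lam i)
      (fun n A j => abs_signalWeight_le A J (hlam i) j)
  have hT2 : ∀ᵐ ω ∂μ, ∀ i, Tendsto (fun n : ℕ => (∑ k, crossWeight (Q n ω) (D n ω) J (lam i)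
      (O n ω *ᵥ β' n ω) k * ε n ω k) / n) atTop (𝓝 0) := by
    refine ae_all_iff.2 fun i => ?_
    refine tendsto_noise_linear hε hε_law
      (u := fun n ω => crossWeight (Q n ω) (D n ω) J (lam i) (O n ω *ᵥ β' n ω))
      (fun n => measurable_crossWeight (hQm n) (hDm n) (measurable_mulVec (hOm n) (hβ n)) J _)
      (fun n => ?_) (B := 1 / lam i ^ 3 * r ^ 2) ?_
    · have hφ : Measurable fun q : Matrix (Fin n) (Fin n) ℝ × Matrix (Fin n) (Fin (p n)) ℝ ×
          Matrix (Fin (p n)) (Fin (p n)) ℝ × (Fin (p n) → ℝ) =>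
          crossWeight q.1 q.2.1 J (lam i) (q.2.2.1 *ᵥ q.2.2.2) :=
        measurable_crossWeight measurable_fst (measurable_fst.comp measurable_snd)
          (measurable_mulVec (measurable_fst.comp (measurable_snd.comp measurable_snd))
            (measurable_snd.comp (measurable_snd.comp measurable_snd))) J _
      exact ((hε_indep n).comp measurable_id hφ).symm
    · filter_upwards [hβ_norm] with n hn
      filter_upwards [hn] with ω hω
      refine (sum_sq_crossWeight_le (hQ n ω) (hD n ω) J (hlam i) _).trans (le_of_eq ?_)
      rw [sum_sq_mulVec_of_mem_orthogonal (hO n ω), hω, mul_assoc]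
  have hT3 : ∀ᵐ ω ∂μ, ∀ i, Tendsto (fun n : ℕ => (∑ k, noiseWeight (D n ω) J (lam i) k *
      ((Q n ω *ᵥ ε n ω) k ^ 2 - v)) / n) atTop (𝓝 0) := by
    refine ae_all_iff.2 fun i => ?_
    refine tendsto_noise_quadratic hε hε_law hQm hQ
      (c := fun n ω => noiseWeight (D n ω) J (lam i))
      (fun n => (measurable_noiseWeight J _).comp (hDm n))
      (fun n ω k => abs_noiseWeight_le (hD n ω) J (hlam i) k) (fun n => ?_)
    exact ((hε_indep n).comp measurable_id (measurable_fst.prodMk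
      ((measurable_noiseWeight J (lam i)).comp (measurable_fst.comp measurable_snd)))).symm
  -- The quantifier over g stands inside the almost sure event, so that g may depend on ω, as p/k
  -- does through the random k.
  have hest : ∀ᵐ ω ∂μ, (∃ κ : ℝ, 0 < κ ∧ ∀ᶠ n : ℕ in atTop,
      κ * n ≤ (residualIndices (D n ω) J).card ∧ ((residualIndices (D n ω) J).card : ℝ) ≤ n) ∧
      ∀ (g : ℕ → ℝ) (g₁ g₂ : ℝ), 0 < g₁ → 0 < g₂ → (∀ᶠ n in atTop, g₁ ≤ g n ∧ g n ≤ g₂) →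
      Tendsto (fun n => reducedRSqHat (g n) lam J (X n ω) (D n ω) (O n ω) (y n ω)
        - r ^ 2 * n / p n * g n) atTop (𝓝 0) ∧
      Tendsto (fun n => reducedSigmaSqHat (g n) lam J (X n ω) (D n ω) (O n ω) (y n ω))
        atTop (𝓝 (v : ℝ)) := by
    filter_upwards [hC, hspread, hT1, hT2, hT3] with ω hCω hsω h1 h2 h3
    obtain ⟨c, hc, hs⟩ := hsω
    constructor
    · refine ⟨c / (2 * (C ^ 2 + 1) ^ 2), by positivity, ?_⟩
      have hJ' : ∀ᶠ n : ℕ in atTop, (J.card : ℝ) * (C ^ 2 + 1) ^ 2 ≤ c / 2 * n :=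
        (tendsto_natCast_atTop_atTop.const_mul_atTop (half_pos hc)).eventually_ge_atTop _
      filter_upwards [hCω, hs, hJ', eventually_gt_atTop 0] with n hCn hsn hJn hn
      exact (residual_spread hn (hD n ω) ((hX n).diag_nonneg ω) hCn hc hsn hJn).2
    · intro g g₁ g₂ hg₁ hg₂ hg
      simp only [hXdef, hydef]
      exact tendsto_reduced_estimators (fun n => hQ n ω) (fun n => hO n ω)
        (fun n => (hX n).diag_nonneg ω) (fun n => hD n ω) hCω hc hs J α
        (s := fun n => r ^ 2 * n / p n) hlam hgrid h1 h2 h3 hg₁ hg₂ hg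
  have hratio : ∀ᶠ n : ℕ in atTop, γ / 2 ≤ (p n : ℝ) / n ∧ (p n : ℝ) / n ≤ 2 * γ :=
    (hp.eventually_const_le (half_lt_self hγ)).and (hp.eventually_le_const (by linarith))
  have hppos : ∀ᶠ n in atTop, (0 : ℝ) < p n :=
    (hptop.eventually_gt_atTop 0).mono fun n hn => by exact_mod_cast hn
  have hreduced : ∀ᵐ ω ∂μ, Tendsto (fun n =>
        reducedRSqHat ((p n : ℝ) / (residualIndices (D n ω) J).card) lam J
            (X n ω) (D n ω) (O n ω) (y n ω)
          - r ^ 2 * n / p n * ((p n : ℝ) / (residualIndices (D n ω) J).card)) atTop (𝓝 0) ∧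
      Tendsto (fun n => reducedSigmaSqHat ((p n : ℝ) / (residualIndices (D n ω) J).card) lam J
        (X n ω) (D n ω) (O n ω) (y n ω)) atTop (𝓝 (v : ℝ)) := by
    filter_upwards [hest] with ω ⟨⟨κ, hκ, hk⟩, h⟩
    refine h _ (γ / 2) (2 * γ / κ) (by positivity) (by positivity) ?_
    filter_upwards [hk, hratio, eventually_gt_atTop 0] with n ⟨hk1, hk2⟩ ⟨hr1, hr2⟩ hn
    have hn' : (0 : ℝ) < n := by exact_mod_cast hn
    have hkpos : (0 : ℝ) < (residualIndices (D n ω) J).card := lt_of_lt_of_le (by positivity) hk1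
    constructor
    · exact hr1.trans (div_le_div_of_nonneg_left (by positivity) hkpos hk2)
    · calc (p n : ℝ) / (residualIndices (D n ω) J).card ≤ p n / (κ * n) :=
            div_le_div_of_nonneg_left (by positivity) (by positivity) hk1
        _ = (p n : ℝ) / n / κ := by rw [mul_comm, div_div]
        _ ≤ _ := by gcongr
  refine ⟨fun i hi => ?_, ?_, ?_, ?_, ?_⟩
  · have hsig := hsignal (fun n _ j => if j.val = i then 1 else 0) (fun n => measurable_const) 1
      (fun n A j => by split_ifs <;> simp)
    have hlin : ∀ᵐ ω ∂μ, Tendsto (fun n : ℕ =>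
        (∑ k, ((Q n ω)ᵀ *ᵥ (D n ω *ᵥ componentSelector (D n ω) i)) k * ε n ω k) / n)
        atTop (𝓝 0) := by
      have hφ : ∀ {n : ℕ} {E : Type} [MeasurableSpace E] {A : E → Matrix (Fin n) (Fin n) ℝ}
          {B : E → Matrix (Fin n) (Fin (p n)) ℝ}, Measurable A → Measurable B →
          Measurable fun x => (A x)ᵀ *ᵥ (B x *ᵥ componentSelector (B x) i) := fun hA hB =>
        measurable_mulVec (measurable_matrix_transpose hA)
          (measurable_mulVec hB ((measurable_componentSelector i).comp hB))
      refine tendsto_noise_linear hε hε_law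
        (u := fun n ω => (Q n ω)ᵀ *ᵥ (D n ω *ᵥ componentSelector (D n ω) i))
        (fun n => measurable_mulVec (measurable_matrix_transpose (hQm n))
          (measurable_mulVec (hDm n) ((measurable_componentSelector i).comp (hDm n))))
        (fun n => ?_) (B := 1) ?_
      · exact ((hε_indep n).comp measurable_id
          (hφ measurable_fst (measurable_fst.comp measurable_snd))).symm
      · refine Eventually.of_forall fun n => ae_of_all _ fun ω => ?_
        rw [sum_sq_transpose_mulVec_mulVec (hQ n ω) (hD n ω), one_mul]
        exact sum_gram_mul_componentSelector_sq_le (D n ω) i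
    have hJae : ∀ᵐ ω ∂μ, ∀ k ∈ J, ∃ c > 0, ∀ᶠ n in atTop,
        ∀ j : Fin (p n), j.val = k → c ≤ ((D n ω)ᵀ * D n ω) j j :=
      (ae_ball_iff J.countable_toSet).2 hJ
    filter_upwards [hsig, hlin, hJae] with ω h1 h2 h3
    simp only [hXdef, hydef]
    exact tendsto_alphaHat hptop (fun n => hQ n ω) (fun n => hO n ω) (fun n => hD n ω) α h3 hi h1 h2
  · filter_upwards [hest] with ω ⟨_, h⟩
    refine tendsto_sub_nhds_zero_iff.1
      ((h _ (γ / 2) (2 * γ) (by positivity) (by positivity) hratio).1.congr' ?_)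
    -- Here (r² n/p)(p/n) = r².
    filter_upwards [hppos, eventually_gt_atTop 0] with n hpn hn
    have hn' : (0 : ℝ) < n := by exact_mod_cast hn
    congr 1
    field_simp
  · filter_upwards [hest] with ω ⟨_, h⟩
    exact (h _ (γ / 2) (2 * γ) (by positivity) (by positivity) hratio).2
  · have hnorm : ∀ᵐ ω ∂μ, ∀ᶠ n : ℕ in atTop, ∑ j, (β' n ω j) ^ 2 = r ^ 2 * n := by
      obtain ⟨N, hN⟩ := eventually_atTop.1 hβ_norm
      have h : ∀ᵐ ω ∂μ, ∀ n : ℕ, N ≤ n → ∑ j, (β' n ω j) ^ 2 = r ^ 2 * n :=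
        ae_all_iff.2 fun n => ae_all_iff.2 fun hn => hN n hn
      filter_upwards [h] with ω hω
      exact eventually_atTop.2 ⟨N, hω⟩
    filter_upwards [hreduced, hnorm] with ω ⟨h, _⟩ hnω
    refine h.congr' ?_
    -- Here (r² n/p)(p/k) = r² n/k, and r² n is the squared norm of β'.
    filter_upwards [hnω, hppos] with n hn hpn
    rw [hn]
    congr 1
    field_simp
  · filter_upwards [hreduced] with ω ⟨_, h⟩
    exact h
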